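/- Fix an o-minimal structure expanding the real field; "definable" means that the set (for maps: the graph) belongs to it, and a family $(Z_t)_{t\in[0,1]}$ of subsets of $\mathbb{R}^n$ is definable if $\bigcup_t\{t\}\times Z_t$ is (a family of maps is definable if the family of their graphs is). For a definable set $A\subset\mathbb{R}^n$ let $\mathcal{D}^+(A)$ be the set of positive definable continuous functions on $A$. Let $2\le k\le\infty$ and let $M\subset\mathbb{R}^n$ be a closed definable $\mathscr{C}^k$ submanifold. A definable tubular neighborhood of $M$ is a pair $(U,r)$, where $U$ is an open definable neighborhood of $M$ and $r:U\to M$ is a definable $\mathscr{C}^{k-1}$ retraction such that, for each $x\in U$, $r(x)$ is the unique point of $M$ realizing the distance from $x$ to $M$. For $1\le p\le k$, a definable deformation of $M$ (of class $\mathscr{C}^p$) is a definable family $(Z_t)_{t\in[0,1]}$ of $\mathscr{C}^p$ submanifolds of $\mathbb{R}^n$ with $Z_0=M$. For $\varepsilon\in\mathcal{D}^+(M)$, an $(\varepsilon,\mathscr{C}^p)$ trivialization of it is a family of $\mathscr{C}^p$ diffeomorphisms $\varphi_t:M\to Z_t$, $t\in[0,1]$, such that $(t,x)\mapsto\varphi_t(x)$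 is $\mathscr{C}^p$ on $[0,1]\times M$, $\varphi_0=\mathrm{id}_M$, and $$|x-\varphi_t(x)|<\varepsilon(x),\qquad |u-d_x\varphi_t(u)|<\varepsilon(x)$$ for all $t\in[0,1]$, all $x\in M$ and all unit vectors $u\in T_xM$. The deformation is $(\varepsilon,\mathscr{C}^p)$ trivial if it has such a trivialization, and definably $(\varepsilon,\mathscr{C}^p)$ trivial if it has one that is a definable family of mappings. **Statement.** Let $M\subset\mathbb{R}^n$ be a closed definable $\mathscr{C}^k$ submanifold, $2\le k\le\infty$ (with $\infty-1=\infty$), and let $\varepsilon\in\mathcal{D}^+(M)$. Then $M$ has a definable tubular neighborhood, and for every definable tubular neighborhood $(U,r)$ of $M$ there is $\delta\in\mathcal{D}^+(M)$ such that every definable deformation $(Z_t)_{t\in[0,1]}$ of $M$ of class $\mathscr{C}^{k-1}$ that is $(\delta,\mathscr{C}^{k-1})$ trivial is definably $(\varepsilon,\mathscr{C}^{k-1})$ trivial. More precisely, for each $t$ one has $Z_t\subset U$, the restriction $r_{|Z_t}:Z_t\to M$ is a bijection, and the maps $\varphi_t:=(r_{|Z_t})^{-1}$ form a definable $(\varepsilon,\mathscr{C}^{k-1})$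 trivialization. -/

import Mathlib

open Set Filter Topology

/-- An o-minimal structure expanding the real field: for every `n`, a Boolean algebra `Def n` of
subsets of `ℝⁿ` containing the algebraic sets, stable under products and linear projections, and
such that the members of `Def 1` are exactly the finite unions of points and intervals. -/
structure OMinimalStructure where
  Def : ∀ n : ℕ, Set (Set (Fin n → ℝ))
  compl_mem : ∀ {n : ℕ} {A : Set (Fin n → ℝ)}, A ∈ Def n → Aᶜ ∈ Def n
  union_mem : ∀ {n : ℕ} {A B : Set (Fin n → ℝ)}, A ∈ Def n → B ∈ Def n → A ∪ B ∈ Def n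
  algebraic_mem : ∀ {n : ℕ} (P : Set (MvPolynomial (Fin n) ℝ)),
    {x : Fin n → ℝ | ∀ p ∈ P, MvPolynomial.eval x p = 0} ∈ Def n
  prod_mem : ∀ {m n : ℕ} {A : Set (Fin m → ℝ)} {B : Set (Fin n → ℝ)}, A ∈ Def m → B ∈ Def n →
    {w : Fin (m + n) → ℝ | ∃ x ∈ A, ∃ y ∈ B, w = Fin.append x y} ∈ Def (m + n)
  proj_mem : ∀ {n : ℕ} {A : Set (Fin (n + 1) → ℝ)}, A ∈ Def (n + 1) →
    {x : Fin n → ℝ | ∃ s : ℝ, (Fin.snoc x s : Fin (n + 1) → ℝ) ∈ A} ∈ Def n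
  /-- The order-connected subsets of `ℝ` are the intervals, bounded or not, including points and
  the empty set. -/
  mem_one_iff : ∀ A : Set (Fin 1 → ℝ), A ∈ Def 1 ↔
    ∃ F : Set (Set ℝ), F.Finite ∧ (∀ I ∈ F, I.OrdConnected) ∧ A = {x | x 0 ∈ ⋃₀ F}

namespace OMinimalStructure

variable (S : OMinimalStructure)

/-- Definable subsets of Euclidean space. -/
def IsDefinable {n : ℕ} (A : Set (EuclideanSpace ℝ (Fin n))) : Prop :=
  {x : Fin n → ℝ | WithLp.toLp 2 x ∈ A} ∈ S.Def n

/-- The map `f : A → ℝᵐ` is definable: its graph is. -/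
def IsDefinableMap {n m : ℕ} (A : Set (EuclideanSpace ℝ (Fin n)))
    (f : EuclideanSpace ℝ (Fin n) → EuclideanSpace ℝ (Fin m)) : Prop :=
  {w : Fin (n + m) → ℝ | ∃ x ∈ A, w = Fin.append x.ofLp (f x).ofLp} ∈ S.Def (n + m)

/-- The real-valued function `f : A → ℝ` is definable: its graph is. -/
def IsDefinableFun {n : ℕ} (A : Set (EuclideanSpace ℝ (Fin n)))
    (f : EuclideanSpace ℝ (Fin n) → ℝ) : Prop :=
  {w : Fin (n + 1) → ℝ | ∃ x ∈ A, w = (Fin.snoc x.ofLp (f x) : Fin (n + 1) → ℝ)} ∈ S.Def (n + 1)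

/-- `(Z_t)`, `t ∈ [0,1]`, is a definable family: `⋃ₜ {t} × Z_t` is definable. -/
def IsDefinableFamily {n : ℕ} (Z : ℝ → Set (EuclideanSpace ℝ (Fin n))) : Prop :=
  {w : Fin (n + 1) → ℝ | ∃ t ∈ Icc (0 : ℝ) 1, ∃ z ∈ Z t,
    w = (Fin.cons t z.ofLp : Fin (n + 1) → ℝ)} ∈ S.Def (n + 1)

/-- `(φ_t : A → ℝᵐ)`, `t ∈ [0,1]`, is a definable family of mappings: the family of the graphs is
definable. -/
def IsDefinableMapFamily {n m : ℕ} (A : Set (EuclideanSpace ℝ (Fin n)))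
    (φ : ℝ → EuclideanSpace ℝ (Fin n) → EuclideanSpace ℝ (Fin m)) : Prop :=
  {w : Fin (n + m + 1) → ℝ | ∃ t ∈ Icc (0 : ℝ) 1, ∃ x ∈ A,
    w = (Fin.cons t (Fin.append x.ofLp (φ t x).ofLp) : Fin (n + m + 1) → ℝ)} ∈ S.Def (n + m + 1)

/-- `f ∈ 𝒟⁺(A)`: `f` is a positive definable continuous function on `A`
(the values of `f` outside `A` are irrelevant). -/
structure IsPosDefinable {n : ℕ} (A : Set (EuclideanSpace ℝ (Fin n)))
    (f : EuclideanSpace ℝ (Fin n) → ℝ) : Prop where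
  definable : S.IsDefinableFun A f
  continuousOn : ContinuousOn f A
  pos : ∀ x ∈ A, 0 < f x

end OMinimalStructure

/-- `M ⊆ ℝⁿ` is a `C^p` submanifold: around each of its points a local `C^p` diffeomorphism `Ψ` of
the ambient space carries `M` to a linear subspace `V` (whose dimension is the dimension of `M` at
that point). -/
def IsSubmanifold {n : ℕ} (p : ℕ∞) (M : Set (EuclideanSpace ℝ (Fin n))) : Prop :=
  ∀ x ∈ M, ∃ (Ψ : OpenPartialHomeomorph (EuclideanSpace ℝ (Fin n)) (EuclideanSpace ℝ (Fin n)))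
    (V : Submodule ℝ (EuclideanSpace ℝ (Fin n))),
    x ∈ Ψ.source ∧ ContDiffOn ℝ p Ψ Ψ.source ∧ ContDiffOn ℝ p Ψ.symm Ψ.target ∧
      ∀ y ∈ Ψ.source, y ∈ M ↔ Ψ y ∈ V

/-- The tangent space `T_x M`: the velocities at `x` of the curves in `M` through `x`. -/
def tangentVectors {n : ℕ} (M : Set (EuclideanSpace ℝ (Fin n))) (x : EuclideanSpace ℝ (Fin n)) :
    Set (EuclideanSpace ℝ (Fin n)) :=
  {u | ∃ γ : ℝ → EuclideanSpace ℝ (Fin n),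
    γ 0 = x ∧ (∀ᶠ s in 𝓝 (0 : ℝ), γ s ∈ M) ∧ HasDerivAt γ u 0}

/-- On tangent vectors, the derivative within `M` does not depend on any choice: it is the
differential `d_x f` of the map `f` on `M`. -/
theorem fderivWithin_apply_tangentVector {n m : ℕ} {M : Set (EuclideanSpace ℝ (Fin n))}
    {x u : EuclideanSpace ℝ (Fin n)} {f : EuclideanSpace ℝ (Fin n) → EuclideanSpace ℝ (Fin m)}
    {γ : ℝ → EuclideanSpace ℝ (Fin n)} (hf : DifferentiableWithinAt ℝ f M x)
    (h0 : γ 0 = x) (hγ : ∀ᶠ s in 𝓝 (0 : ℝ), γ s ∈ M) (hd : HasDerivAt γ u 0) :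
    HasDerivAt (f ∘ γ) (fderivWithin ℝ f M x u) 0 := by
  subst h0
  have h1 : HasFDerivWithinAt f (fderivWithin ℝ f M (γ 0)) M (γ 0) := hf.hasFDerivWithinAt
  have h2 : HasDerivWithinAt (f ∘ γ) (fderivWithin ℝ f M (γ 0) u) (γ ⁻¹' M) 0 :=
    h1.comp_hasDerivWithinAt (0 : ℝ) hd.hasDerivWithinAt (fun s hs => hs)
  exact h2.hasDerivAt hγ

/-- `f : A → B` is a `C^p` diffeomorphism. (On a submanifold `A`, being `C^p` in the sense of
`ContDiffOn` is the same as being `C^p` in local coordinates.) -/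
def IsDiffeomorphism {n : ℕ} (p : ℕ∞)
    (f : EuclideanSpace ℝ (Fin n) → EuclideanSpace ℝ (Fin n))
    (A B : Set (EuclideanSpace ℝ (Fin n))) : Prop :=
  ContDiffOn ℝ p f A ∧ MapsTo f A B ∧
    ∃ g : EuclideanSpace ℝ (Fin n) → EuclideanSpace ℝ (Fin n),
      ContDiffOn ℝ p g B ∧ MapsTo g B A ∧ InvOn g f A B

/-- `(U, r)` is a definable tubular neighborhood of the `C^k` submanifold `M`: `U` is an open
definable neighborhood of `M` and `r : U → M` is a definable `C^(k-1)` retraction sending `x` to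
the unique point of `M` that realizes the distance from `x` to `M`. -/
structure IsTubularNeighborhood (S : OMinimalStructure) {n : ℕ} (k : ℕ∞)
    (M U : Set (EuclideanSpace ℝ (Fin n)))
    (r : EuclideanSpace ℝ (Fin n) → EuclideanSpace ℝ (Fin n)) : Prop where
  isOpen : IsOpen U
  subset : M ⊆ U
  definable_nhd : S.IsDefinable U
  definable_map : S.IsDefinableMap U r
  mapsTo : MapsTo r U M
  retraction : ∀ x ∈ M, r x = x
  dist_eq : ∀ x ∈ U, dist x (r x) = Metric.infDist x M
  unique : ∀ x ∈ U, ∀ y ∈ M, dist x y = Metric.infDist x M → y = r x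
  contDiffOn : ContDiffOn ℝ ((k - 1 : ℕ∞) : WithTop ℕ∞) r U

/-- `(Z_t)`, `t ∈ [0,1]`, is a definable deformation of `M`: a definable family of `C^p`
submanifolds with `Z_0 = M`. -/
structure IsDefinableDeformation (S : OMinimalStructure) {n : ℕ} (p : ℕ∞)
    (M : Set (EuclideanSpace ℝ (Fin n))) (Z : ℝ → Set (EuclideanSpace ℝ (Fin n))) : Prop where
  definable : S.IsDefinableFamily Z
  submanifold : ∀ t ∈ Icc (0 : ℝ) 1, IsSubmanifold p (Z t)
  zero : Z 0 = M

/-- `(φ_t)`, `t ∈ [0,1]`, is an `(ε, C^p)` trivialization of the deformation `(Z_t)` of `M`: a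
family of `C^p` diffeomorphisms `φ_t : M → Z_t`, depending in a `C^p` way on `(t, x)`, with
`φ_0 = id`, and `ε`-close to the identity together with its differential on `M`. -/
structure IsTrivialization {n : ℕ} (p : ℕ∞) (ε : EuclideanSpace ℝ (Fin n) → ℝ)
    (M : Set (EuclideanSpace ℝ (Fin n))) (Z : ℝ → Set (EuclideanSpace ℝ (Fin n)))
    (φ : ℝ → EuclideanSpace ℝ (Fin n) → EuclideanSpace ℝ (Fin n)) : Prop where
  diffeo : ∀ t ∈ Icc (0 : ℝ) 1, IsDiffeomorphism p (φ t) M (Z t)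
  contDiffOn : ContDiffOn ℝ p (fun q : ℝ × EuclideanSpace ℝ (Fin n) => φ q.1 q.2)
    (Icc (0 : ℝ) 1 ×ˢ M)
  zero : ∀ x ∈ M, φ 0 x = x
  close : ∀ t ∈ Icc (0 : ℝ) 1, ∀ x ∈ M, ‖x - φ t x‖ < ε x
  close_deriv : ∀ t ∈ Icc (0 : ℝ) 1, ∀ x ∈ M, ∀ u ∈ tangentVectors M x, ‖u‖ = 1 →
    ‖u - fderivWithin ℝ (φ t) M x u‖ < ε x

/-- `(Z_t)` is `(ε, C^p)` trivial. -/
def IsTrivial {n : ℕ} (p : ℕ∞) (ε : EuclideanSpace ℝ (Fin n) → ℝ)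
    (M : Set (EuclideanSpace ℝ (Fin n))) (Z : ℝ → Set (EuclideanSpace ℝ (Fin n))) : Prop :=
  ∃ φ : ℝ → EuclideanSpace ℝ (Fin n) → EuclideanSpace ℝ (Fin n), IsTrivialization p ε M Z φ

/-- `(φ_t)` is a definable `(ε, C^p)` trivialization of `(Z_t)`; the deformation `(Z_t)` is
definably `(ε, C^p)` trivial when there is one. -/
structure IsDefinableTrivialization (S : OMinimalStructure) {n : ℕ} (p : ℕ∞)
    (ε : EuclideanSpace ℝ (Fin n) → ℝ)
    (M : Set (EuclideanSpace ℝ (Fin n))) (Z : ℝ → Set (EuclideanSpace ℝ (Fin n)))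
    (φ : ℝ → EuclideanSpace ℝ (Fin n) → EuclideanSpace ℝ (Fin n)) : Prop
    extends IsTrivialization p ε M Z φ where
  definable : S.IsDefinableMapFamily M φ

/-!
No o-minimality beyond closure under first-order constructions is needed: both halves reduce the
theorem to elementary differential geometry together with objects given by first-order formulas.

*Existence of a tubular neighborhood.* A point `p ∈ M` is a foot point of `y` if it is nearest to
`y` and remains nearest to some point beyond `y` on the ray from `p` through `y` (`IsFootPoint`).
This is a first-order condition, so the interior `U` of the set of points with a foot point is
definable, for `k = ∞` as well. It contains `M`, since a `C²` submanifold bends at most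
quadratically (`IsSubmanifold.eventually_exists_isFootPoint`). Foot points are unique and depend
continuously on `y`. As `p` stays nearest beyond `y`, the Hessian at `p` of the squared distance
to `y` is definite on the tangent space, so the implicit function theorem shows that the foot
point is a `C^(k-1)` function of `y` (`IsSubmanifold.contDiffAt_of_isFootPoint`).

*Trivializations.* Given `(U, r)`, let the control radius of `x ∈ M` be the supremum of the radii
of balls around `x` on which `r` is `3`-Lipschitz and its derivative oscillates little, compared
with `1` and `ε`. The oscillation is measured by second differences, so the control radius is
definable; it is positive because `r` is `C¹`, and `1`-Lipschitz because it is defined by balls. A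
small multiple of it serves as `δ`.

If `ψ` is a `(δ, C^(k-1))` trivialization of `Z`, then `r ∘ ψ_t` is a self-map of `M` that is
`C¹`-close to the identity, since the derivative of `r` fixes tangent vectors. Its displacement,
extended to a neighborhood of `M` by composition with `r`, is a contraction on balls of the ambient
space (`IsControlledTrivialization.lipschitz_displacement`). Hence `r ∘ ψ_t` is injective, and a
fixed point argument, jointly smooth in `t` (`exists_contDiffOn_inverse`), gives a local inverse;
comparing the increments of `r` along two translates of one vector shows that this inverse maps `M`
to `M` (`IsControlledTrivialization.exists_local_inverse`). So `r ∘ ψ_t` is a diffeomorphism of `M`,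
and `φ_t = ψ_t ∘ (r ∘ ψ_t)⁻¹` is the inverse of the restriction of `r` to `Z_t`. In the latter form
it is definable, in the former it is smooth and close to the identity.
-/

/-! ### Definability by first-order formulas -/

namespace OMinimalStructure

theorem univ_mem (S : OMinimalStructure) (n : ℕ) : (univ : Set (Fin n → ℝ)) ∈ S.Def n := by
  have h := S.algebraic_mem (n := n) ∅
  simpa using h

theorem inter_mem (S : OMinimalStructure) {n : ℕ} {A B : Set (Fin n → ℝ)} (hA : A ∈ S.Def n)
    (hB : B ∈ S.Def n) : A ∩ B ∈ S.Def n := by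
  have h := S.compl_mem (S.union_mem (S.compl_mem hA) (S.compl_mem hB))
  rwa [Set.compl_union, compl_compl, compl_compl] at h

theorem proj_append_mem (S : OMinimalStructure) {n m : ℕ} {A : Set (Fin (n + m) → ℝ)}
    (hA : A ∈ S.Def (n + m)) :
    {x : Fin n → ℝ | ∃ y : Fin m → ℝ, Fin.append x y ∈ A} ∈ S.Def n := by
  induction m with
  | zero =>
    have h : ∀ (x : Fin n → ℝ) (y : Fin 0 → ℝ), Fin.append x y = x := fun x y => by
      rw [Subsingleton.elim y Fin.elim0, Fin.append_elim0]
      rfl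
    have h' : {x : Fin n → ℝ | ∃ y : Fin 0 → ℝ, Fin.append x y ∈ A} = A :=
      Set.ext fun x => ⟨fun ⟨y, hy⟩ => h x y ▸ hy, fun hx => ⟨Fin.elim0, (h x _).symm ▸ hx⟩⟩
    rw [h']
    exact hA
  | succ m ih =>
    have h := ih (S.proj_mem (n := n + m) hA)
    convert h using 1
    ext x
    constructor
    · rintro ⟨y, hy⟩
      refine ⟨Fin.init y, y (Fin.last m), ?_⟩
      rwa [← Fin.append_snoc, Fin.snoc_init_self]
    · rintro ⟨y, s, hy⟩
      exact ⟨Fin.snoc y s, by rwa [Fin.append_snoc]⟩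

theorem forall_eq_mem (S : OMinimalStructure) {n m : ℕ} (σ τ : Fin m → Fin n) :
    {w : Fin n → ℝ | ∀ j, w (σ j) = w (τ j)} ∈ S.Def n := by
  have h := S.algebraic_mem (n := n)
    (range fun j => (MvPolynomial.X (σ j) - MvPolynomial.X (τ j) : MvPolynomial (Fin n) ℝ))
  convert h using 1
  ext w
  simp [sub_eq_zero]

/-- Definable sets are stable under preimages by maps that duplicate, forget and permute
coordinates. -/
theorem preimage_coord_mem (S : OMinimalStructure) {n m : ℕ} (σ : Fin m → Fin n)
    {A : Set (Fin m → ℝ)} (hA : A ∈ S.Def m) : {x : Fin n → ℝ | x ∘ σ ∈ A} ∈ S.Def n := by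
  have h := S.proj_append_mem (S.inter_mem (S.prod_mem (S.univ_mem n) hA)
    (S.forall_eq_mem (fun j => Fin.castAdd m (σ j)) (fun j => Fin.natAdd n j)))
  convert h using 1
  ext x
  constructor
  · intro hx
    exact ⟨x ∘ σ, ⟨x, mem_univ _, _, hx, rfl⟩, fun j => by simp⟩
  · rintro ⟨y, ⟨x', -, y', hy', h1⟩, h2⟩
    have h3 : y = y' := by
      ext j
      have := congrFun h1 (Fin.natAdd n j)
      simpa using this
    have h4 : x ∘ σ = y := by
      ext j
      have := h2 j
      simpa using this
    change x ∘ σ ∈ A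
    rw [h4, h3]
    exact hy'

/-- A type whose points are described by finitely many real coordinates. It allows definability to
be stated for predicates on products of `ℝ` and Euclidean spaces, hence for first-order formulas
whose variables are real numbers and vectors. -/
class Coordinatized (α : Type*) where
  /-- The number of coordinates. -/
  dim : ℕ
  /-- The coordinates of a point. -/
  coord : α ≃ (Fin dim → ℝ)

open Coordinatized

instance : Coordinatized ℝ := ⟨1, (Equiv.funUnique (Fin 1) ℝ).symm⟩

instance (n : ℕ) : Coordinatized (EuclideanSpace ℝ (Fin n)) := ⟨n, WithLp.equiv 2 _⟩

instance {α β : Type*} [Coordinatized α] [Coordinatized β] : Coordinatized (α × β) :=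
  ⟨dim α + dim β, (Equiv.prodCongr coord coord).trans (Fin.appendEquiv _ _)⟩

section Coordinates

variable {α β γ : Type*} [Coordinatized α] [Coordinatized β] [Coordinatized γ]

theorem coord_prod (a : α) (b : β) : coord (a, b) = Fin.append (coord a) (coord b) := rfl

/-- The predicate `P` on a coordinatized type is definable: the coordinates of the points that
satisfy it form a definable set. -/
def Definable (S : OMinimalStructure) (P : α → Prop) : Prop :=
  {w : Fin (dim α) → ℝ | P (coord.symm w)} ∈ S.Def (dim α)

/-- The map `f` between coordinatized types is definable: its graph is. -/
def DefinableMap (S : OMinimalStructure) (f : α → β) : Prop :=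
  S.Definable fun p : α × β => p.2 = f p.1

variable {S : OMinimalStructure}

/-- Definability may be checked in any coordinates that differ from the chosen ones by a
permutation. -/
theorem definable_iff_of_coord {P : α → Prop} {d : ℕ} (σ : Fin (dim α) ≃ Fin d)
    (c : α → (Fin d → ℝ)) (hσ : ∀ a, c a ∘ σ = coord a) :
    S.Definable P ↔ {w | ∃ a, P a ∧ w = c a} ∈ S.Def d := by
  have hc : ∀ a, c a = coord a ∘ σ.symm := fun a => by
    rw [← hσ]
    ext i
    simp
  constructor
  · intro h
    convert S.preimage_coord_mem σ h using 1
    ext w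
    constructor
    · rintro ⟨a, ha, rfl⟩
      change P (coord.symm (c a ∘ σ))
      rwa [hσ, Equiv.symm_apply_apply]
    · intro hw
      refine ⟨_, hw, ?_⟩
      rw [hc, Equiv.apply_symm_apply]
      ext i
      simp
  · intro h
    unfold Definable
    convert S.preimage_coord_mem σ.symm h using 1
    ext w
    constructor
    · intro hw
      exact ⟨_, hw, by rw [hc, Equiv.apply_symm_apply]⟩
    · rintro ⟨a, ha, h1⟩
      have : coord.symm w = a := by
        rw [Equiv.symm_apply_eq, ← hσ a, ← h1]
        ext i
        simp
      change P _
      rwa [this]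

/-- The map `c` duplicates, forgets and permutes coordinates. -/
def IsCoordMap (c : α → β) : Prop :=
  ∃ σ : Fin (dim β) → Fin (dim α), ∀ a, coord (c a) = coord a ∘ σ

namespace IsCoordMap

theorem id : IsCoordMap fun a : α => a := ⟨fun i => i, fun _ => rfl⟩

theorem comp {c : β → γ} {c' : α → β} (h : IsCoordMap c) (h' : IsCoordMap c') :
    IsCoordMap fun a => c (c' a) := by
  obtain ⟨σ, hσ⟩ := h
  obtain ⟨τ, hτ⟩ := h'
  exact ⟨τ ∘ σ, fun a => by rw [hσ, hτ]; rfl⟩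

theorem fst : IsCoordMap (Prod.fst : α × β → α) :=
  ⟨Fin.castAdd _, fun p => by
    ext i
    rw [← Prod.mk.eta (p := p), coord_prod]
    simp⟩

theorem snd : IsCoordMap (Prod.snd : α × β → β) :=
  ⟨Fin.natAdd _, fun p => by
    ext i
    rw [← Prod.mk.eta (p := p), coord_prod]
    simp⟩

theorem prodMk {c : α → β} {c' : α → γ} (h : IsCoordMap c) (h' : IsCoordMap c') :
    IsCoordMap fun a => (c a, c' a) := by
  obtain ⟨σ, hσ⟩ := h
  obtain ⟨τ, hτ⟩ := h'
  refine ⟨Fin.append σ τ, fun a => ?_⟩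
  rw [coord_prod, hσ, hτ]
  ext i
  refine Fin.addCases (fun i => ?_) (fun i => ?_) i <;> simp

theorem apply {n : ℕ} (i : Fin n) : IsCoordMap fun x : EuclideanSpace ℝ (Fin n) => x i :=
  ⟨fun _ => i, fun _ => rfl⟩

end IsCoordMap

namespace Definable

theorem congr {P Q : α → Prop} (h : S.Definable P) (hPQ : ∀ a, P a ↔ Q a) : S.Definable Q := by
  have : P = Q := funext fun a => propext (hPQ a)
  rwa [← this]

theorem not {P : α → Prop} (h : S.Definable P) : S.Definable fun a => ¬ P a := S.compl_mem h

theorem and {P Q : α → Prop} (h : S.Definable P) (h' : S.Definable Q) :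
    S.Definable fun a => P a ∧ Q a := S.inter_mem h h'

theorem or {P Q : α → Prop} (h : S.Definable P) (h' : S.Definable Q) :
    S.Definable fun a => P a ∨ Q a := S.union_mem h h'

theorem imp {P Q : α → Prop} (h : S.Definable P) (h' : S.Definable Q) :
    S.Definable fun a => P a → Q a :=
  (h.not.or h').congr fun _ => imp_iff_not_or.symm

theorem of_forall {P : α → Prop} (h : ∀ a, P a) : S.Definable P := by
  unfold Definable
  simpa [h] using S.univ_mem _

theorem exists' {P : α → β → Prop} (h : S.Definable fun p : α × β => P p.1 p.2) :
    S.Definable fun a => ∃ b, P a b := by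
  unfold Definable
  convert S.proj_append_mem h using 1
  refine Set.ext fun w => ?_
  have key : ∀ y : Fin (dim β) → ℝ, (coord (α := α × β)).symm (Fin.append w y) =
      (coord.symm w, coord.symm y) := fun y => by
    rw [Equiv.symm_apply_eq, coord_prod, Equiv.apply_symm_apply, Equiv.apply_symm_apply]
  constructor
  · rintro ⟨b, hb⟩
    refine ⟨coord b, ?_⟩
    change P _ _
    rwa [key, Equiv.symm_apply_apply]
  · rintro ⟨y, hy⟩
    change P _ _ at hy
    rw [key] at hy
    exact ⟨_, hy⟩

theorem forall' {P : α → β → Prop} (h : S.Definable fun p : α × β => P p.1 p.2) :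
    S.Definable fun a => ∀ b, P a b :=
  (not (exists' (P := fun a b => ¬ P a b) h.not)).congr fun _ => by simp

theorem forall_fin {m : ℕ} {P : Fin m → α → Prop} (h : ∀ i, S.Definable (P i)) :
    S.Definable fun a => ∀ i, P i a := by
  induction m with
  | zero => exact of_forall fun a i => i.elim0
  | succ m ih => exact ((h 0).and (ih fun i => h i.succ)).congr fun a =>
    (Fin.forall_fin_succ (P := fun i => P i a)).symm

theorem comp_coord {P : β → Prop} (h : S.Definable P) {c : α → β} (hc : IsCoordMap c) :
    S.Definable fun a => P (c a) := by
  obtain ⟨σ, hσ⟩ := hc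
  unfold Definable
  convert S.preimage_coord_mem σ h using 1
  refine Set.ext fun w => ?_
  change P _ ↔ P _
  rw [show c (coord.symm w) = coord.symm (w ∘ σ) by
    rw [Equiv.eq_symm_apply, hσ, Equiv.apply_symm_apply]]

/-- Substitution of a definable map into a definable predicate. -/
theorem comp {P : β → Prop} (h : S.Definable P) {f : α → β} (hf : S.DefinableMap f) :
    S.Definable fun a => P (f a) :=
  (exists' (P := fun a b => b = f a ∧ P b) (and hf (h.comp_coord .snd))).congr fun a => by simp

end Definable

/-- The zero set of a polynomial in the coordinates is definable. -/
theorem definable_of_polynomial (p : MvPolynomial (Fin (dim α)) ℝ) :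
    S.Definable fun a : α => MvPolynomial.eval (coord a) p = 0 := by
  unfold Definable
  simpa using S.algebraic_mem {p}

namespace DefinableMap

theorem congr {f g : α → β} (hf : S.DefinableMap f) (h : ∀ a, f a = g a) : S.DefinableMap g := by
  rwa [← funext h]

theorem prodMk {f : α → β} {g : α → γ} (hf : S.DefinableMap f) (hg : S.DefinableMap g) :
    S.DefinableMap fun a => (f a, g a) :=
  ((hf.comp_coord (IsCoordMap.fst.prodMk (IsCoordMap.fst.comp .snd))).and
    (hg.comp_coord (IsCoordMap.fst.prodMk (IsCoordMap.snd.comp .snd)))).congr fun p => by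
    simp [Prod.ext_iff]

theorem comp {g : β → γ} {f : α → β} (hg : S.DefinableMap g) (hf : S.DefinableMap f) :
    S.DefinableMap fun a => g (f a) :=
  (Definable.exists' (P := fun (p : α × γ) (b : β) => b = f p.1 ∧ p.2 = g b)
    ((hf.comp_coord ((IsCoordMap.fst.comp .fst).prodMk .snd)).and
      (hg.comp_coord (IsCoordMap.snd.prodMk (IsCoordMap.snd.comp .fst))))).congr fun p => by simp

end DefinableMap

theorem IsCoordMap.definableMap {c : α → β} (hc : IsCoordMap c) : S.DefinableMap c := by
  obtain ⟨σ, hσ⟩ := hc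
  have h : S.Definable fun p : α × β => ∀ j, coord p (Fin.natAdd _ j) =
      coord p (Fin.castAdd _ (σ j)) := by
    unfold Definable
    simpa using S.forall_eq_mem (n := dim (α × β)) (fun j => Fin.natAdd _ j)
      (fun j => Fin.castAdd _ (σ j))
  refine h.congr fun p => ?_
  rw [← coord.apply_eq_iff_eq, hσ, funext_iff]
  refine forall_congr' fun j => ?_
  rw [← Prod.mk.eta (p := p), coord_prod]
  simp

theorem definableMap_add : S.DefinableMap fun p : ℝ × ℝ => p.1 + p.2 := by
  refine (definable_of_polynomial (α := (ℝ × ℝ) × ℝ)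
    (.X (Fin.natAdd 2 (0 : Fin 1)) - (.X (Fin.castAdd 1 (Fin.castAdd 1 (0 : Fin 1))) +
      .X (Fin.castAdd 1 (Fin.natAdd 1 (0 : Fin 1)))))).congr fun p => ?_
  rw [map_sub, map_add, MvPolynomial.eval_X, MvPolynomial.eval_X, MvPolynomial.eval_X]
  exact sub_eq_zero

theorem definableMap_mul : S.DefinableMap fun p : ℝ × ℝ => p.1 * p.2 := by
  refine (definable_of_polynomial (α := (ℝ × ℝ) × ℝ)
    (.X (Fin.natAdd 2 (0 : Fin 1)) - (.X (Fin.castAdd 1 (Fin.castAdd 1 (0 : Fin 1))) *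
      .X (Fin.castAdd 1 (Fin.natAdd 1 (0 : Fin 1)))))).congr fun p => ?_
  rw [map_sub, map_mul, MvPolynomial.eval_X, MvPolynomial.eval_X, MvPolynomial.eval_X]
  exact sub_eq_zero

theorem definableMap_const_real (c : ℝ) : S.DefinableMap fun _ : α => c := by
  refine (definable_of_polynomial (α := α × ℝ)
    (.X (Fin.natAdd (dim α) (0 : Fin 1)) - .C c)).congr fun p => ?_
  rw [map_sub, MvPolynomial.eval_C, MvPolynomial.eval_X, ← Prod.mk.eta (p := p), coord_prod,
    Fin.append_right, sub_eq_zero]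
  rfl

theorem Definable.eq {f g : α → β} (hf : S.DefinableMap f) (hg : S.DefinableMap g) :
    S.Definable fun a => f a = g a :=
  Definable.comp (P := fun p : β × β => p.2 = p.1) IsCoordMap.id.definableMap (hg.prodMk hf)

namespace DefinableMap

theorem fst {f : α → β × γ} (hf : S.DefinableMap f) : S.DefinableMap fun a => (f a).1 :=
  IsCoordMap.fst.definableMap.comp hf

theorem snd {f : α → β × γ} (hf : S.DefinableMap f) : S.DefinableMap fun a => (f a).2 :=
  IsCoordMap.snd.definableMap.comp hf

theorem id : S.DefinableMap fun a : α => a := IsCoordMap.id.definableMap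

theorem add {f g : α → ℝ} (hf : S.DefinableMap f) (hg : S.DefinableMap g) :
    S.DefinableMap fun a => f a + g a :=
  definableMap_add.comp (hf.prodMk hg)

theorem mul {f g : α → ℝ} (hf : S.DefinableMap f) (hg : S.DefinableMap g) :
    S.DefinableMap fun a => f a * g a :=
  definableMap_mul.comp (hf.prodMk hg)

theorem sub {f g : α → ℝ} (hf : S.DefinableMap f) (hg : S.DefinableMap g) :
    S.DefinableMap fun a => f a - g a :=
  (hf.add ((definableMap_const_real (-1)).mul hg)).congr fun a => by
    rw [neg_one_mul, ← sub_eq_add_neg]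

theorem sum {n : ℕ} {f : Fin n → α → ℝ} (hf : ∀ i, S.DefinableMap (f i)) :
    S.DefinableMap fun a => ∑ i, f i a := by
  induction n with
  | zero => exact (definableMap_const_real 0).congr fun a => by simp
  | succ n ih =>
    exact ((hf 0).add (ih fun i => hf i.succ)).congr fun a =>
      (Fin.sum_univ_succ fun i => f i a).symm

end DefinableMap

theorem Definable.lt {f g : α → ℝ} (hf : S.DefinableMap f) (hg : S.DefinableMap g) :
    S.Definable fun a => f a < g a := by
  refine (Definable.exists' (P := fun a (z : ℝ) => ¬ z = 0 ∧ g a = f a + z * z)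
    ((Definable.eq (.snd .id) (definableMap_const_real 0)).not.and
      (Definable.eq (hg.comp (.fst .id)) ((hf.comp (.fst .id)).add
        ((DefinableMap.snd .id).mul (.snd .id)))))).congr fun a => ?_
  constructor
  · rintro ⟨z, hz, h⟩
    have := mul_self_pos.2 hz
    linarith
  · intro h
    refine ⟨√(g a - f a), (Real.sqrt_pos.2 (sub_pos.2 h)).ne', ?_⟩
    rw [Real.mul_self_sqrt (sub_pos.2 h).le]
    ring

theorem Definable.le {f g : α → ℝ} (hf : S.DefinableMap f) (hg : S.DefinableMap g) :
    S.Definable fun a => f a ≤ g a :=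
  (Definable.lt hg hf).not.congr fun _ => not_lt

section Euclidean

variable {n : ℕ} {f g : α → EuclideanSpace ℝ (Fin n)}

theorem DefinableMap.apply (hf : S.DefinableMap f) (i : Fin n) :
    S.DefinableMap fun a => f a i :=
  (IsCoordMap.apply i).definableMap.comp hf

theorem DefinableMap.euclidean (hf : ∀ i, S.DefinableMap fun a => f a i) :
    S.DefinableMap f :=
  (Definable.forall_fin fun i => Definable.eq (DefinableMap.apply (.snd .id) i)
    ((hf i).comp (.fst .id))).congr fun p => ⟨fun h => by ext i; exact h i, fun h i => by rw [h]⟩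

theorem DefinableMap.const_euclidean (c : EuclideanSpace ℝ (Fin n)) :
    S.DefinableMap fun _ : α => c :=
  .euclidean fun i => definableMap_const_real (c i)

theorem DefinableMap.vadd (hf : S.DefinableMap f) (hg : S.DefinableMap g) :
    S.DefinableMap fun a => f a + g a :=
  .euclidean fun i => (hf.apply i).add (hg.apply i)

theorem DefinableMap.vsub (hf : S.DefinableMap f) (hg : S.DefinableMap g) :
    S.DefinableMap fun a => f a - g a :=
  .euclidean fun i => (hf.apply i).sub (hg.apply i)

theorem DefinableMap.inner (hf : S.DefinableMap f) (hg : S.DefinableMap g) :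
    S.DefinableMap fun a => inner ℝ (f a) (g a) :=
  (DefinableMap.sum fun i => (hf.apply i).mul (hg.apply i)).congr fun a => by
    simp [PiLp.inner_apply, mul_comm]

theorem DefinableMap.norm (hf : S.DefinableMap f) : S.DefinableMap fun a => ‖f a‖ :=
  Definable.congr ((Definable.le (definableMap_const_real 0) (.snd .id)).and
    (Definable.eq ((DefinableMap.snd .id).mul (.snd .id))
      ((hf.inner hf).comp (.fst .id)))) fun p => by
    rw [real_inner_self_eq_norm_mul_norm]
    constructor
    · rintro ⟨h0, h⟩
      exact (mul_self_inj h0 (norm_nonneg _)).1 h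
    · intro h
      rw [h]
      exact ⟨norm_nonneg _, rfl⟩

theorem DefinableMap.dist (hf : S.DefinableMap f) (hg : S.DefinableMap g) :
    S.DefinableMap fun a => dist (f a) (g a) :=
  (hf.vsub hg).norm.congr fun _ => (dist_eq_norm _ _).symm

end Euclidean

open Classical in
/-- Extension of a definable map by a constant. -/
theorem DefinableMap.ite_const {A : α → Prop} (hA : S.Definable A) {f : α → β}
    (hf : S.Definable fun p : α × β => A p.1 ∧ p.2 = f p.1) {c : β}
    (hc : S.DefinableMap fun _ : α => c) : S.DefinableMap fun a => if A a then f a else c :=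
  (hf.or ((hA.comp (.fst .id)).not.and hc)).congr fun p => by
    by_cases h : A p.1 <;> simp [h]

end Coordinates

section Defs

variable {S : OMinimalStructure} {n m : ℕ}

theorem isDefinableMap_iff {A : Set (EuclideanSpace ℝ (Fin n))}
    {f : EuclideanSpace ℝ (Fin n) → EuclideanSpace ℝ (Fin m)} :
    S.IsDefinableMap A f ↔ S.Definable fun p : EuclideanSpace ℝ (Fin n) ×
      EuclideanSpace ℝ (Fin m) => p.1 ∈ A ∧ p.2 = f p.1 := by
  rw [definable_iff_of_coord (Equiv.refl _) (fun p : EuclideanSpace ℝ (Fin n) ×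
      EuclideanSpace ℝ (Fin m) => Fin.append p.1.ofLp p.2.ofLp) fun a => rfl, IsDefinableMap]
  refine iff_of_eq (congrArg (· ∈ S.Def (n + m)) (Set.ext fun w => ?_))
  rw [mem_ofPred_eq]
  simp only [Prod.exists, and_assoc, exists_and_left, exists_eq_left]
  rfl

theorem isDefinableFun_iff {A : Set (EuclideanSpace ℝ (Fin n))}
    {f : EuclideanSpace ℝ (Fin n) → ℝ} :
    S.IsDefinableFun A f ↔ S.Definable fun p : EuclideanSpace ℝ (Fin n) × ℝ =>
      p.1 ∈ A ∧ p.2 = f p.1 := by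
  rw [definable_iff_of_coord (Equiv.refl _) (fun p : EuclideanSpace ℝ (Fin n) × ℝ =>
      (Fin.snoc p.1.ofLp p.2 : Fin (n + 1) → ℝ)) fun a =>
        (Fin.append_right_eq_snoc a.1.ofLp fun _ => a.2).symm, IsDefinableFun]
  refine iff_of_eq (congrArg (· ∈ S.Def (n + 1)) (Set.ext fun w => ?_))
  rw [mem_ofPred_eq]
  simp only [Prod.exists, and_assoc, exists_and_left, exists_eq_left]
  rfl

theorem isDefinableFamily_iff {Z : ℝ → Set (EuclideanSpace ℝ (Fin n))} :
    S.IsDefinableFamily Z ↔ S.Definable fun p : ℝ × EuclideanSpace ℝ (Fin n) =>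
      p.1 ∈ Icc (0 : ℝ) 1 ∧ p.2 ∈ Z p.1 := by
  rw [definable_iff_of_coord (finCongr (Nat.add_comm 1 n)) (fun p : ℝ × EuclideanSpace ℝ (Fin n) =>
      (Fin.cons p.1 p.2.ofLp : Fin (n + 1) → ℝ)) fun a => ?_, IsDefinableFamily]
  · refine iff_of_eq (congrArg (· ∈ S.Def (n + 1)) (Set.ext fun w => ?_))
    simp only [mem_ofPred_eq, Prod.exists, and_assoc]
    exact ⟨fun ⟨t, ht, z, hz, h⟩ => ⟨t, z, ht, hz, h⟩, fun ⟨t, z, ht, hz, h⟩ => ⟨t, ht, z, hz, h⟩⟩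
  · exact (Fin.append_left_eq_cons (fun _ => a.1) a.2.ofLp).symm

theorem isDefinableMapFamily_iff {A : Set (EuclideanSpace ℝ (Fin n))}
    {φ : ℝ → EuclideanSpace ℝ (Fin n) → EuclideanSpace ℝ (Fin m)} :
    S.IsDefinableMapFamily A φ ↔ S.Definable fun p : ℝ × (EuclideanSpace ℝ (Fin n) ×
      EuclideanSpace ℝ (Fin m)) =>
      p.1 ∈ Icc (0 : ℝ) 1 ∧ p.2.1 ∈ A ∧ p.2.2 = φ p.1 p.2.1 := by
  rw [definable_iff_of_coord (finCongr (Nat.add_comm 1 (n + m)))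
    (fun p : ℝ × (EuclideanSpace ℝ (Fin n) × EuclideanSpace ℝ (Fin m)) =>
      (Fin.cons p.1 (Fin.append p.2.1.ofLp p.2.2.ofLp) : Fin (n + m + 1) → ℝ)) fun a => ?_,
    IsDefinableMapFamily]
  · refine iff_of_eq (congrArg (· ∈ S.Def (n + m + 1)) (Set.ext fun w => ?_))
    simp [and_assoc]
  · exact (Fin.append_left_eq_cons (fun _ => a.1) (Fin.append a.2.1.ofLp a.2.2.ofLp)).symm

end Defs
end OMinimalStructure

/-! ### Foot points -/

section
variable {n : ℕ}

/-- `p ∈ M` is nearest to `y`, and remains nearest to a point beyond `y` on the ray from `p` through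
`y`: expanding squares, the inequality says that `p` is a nearest point of `M` to
`p + (1 + η) (y - p)`. -/
def IsFootPoint (M : Set (EuclideanSpace ℝ (Fin n))) (y p : EuclideanSpace ℝ (Fin n)) : Prop :=
  p ∈ M ∧ ∃ η : ℝ, 0 < η ∧ ∀ q ∈ M, 2 * (1 + η) * inner ℝ (y - p) (q - p) ≤ ‖q - p‖ ^ 2

variable {M : Set (EuclideanSpace ℝ (Fin n))} {x y p q : EuclideanSpace ℝ (Fin n)}

theorem norm_sub_sq_eq_add (y p q : EuclideanSpace ℝ (Fin n)) :
    ‖y - q‖ ^ 2 = ‖y - p‖ ^ 2 - 2 * inner ℝ (y - p) (q - p) + ‖q - p‖ ^ 2 := by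
  rw [← norm_sub_sq_real, sub_sub_sub_cancel_right]

namespace IsFootPoint

theorem norm_le (h : IsFootPoint M y p) (hq : q ∈ M) : ‖y - p‖ ≤ ‖y - q‖ := by
  obtain ⟨-, η, hη, h⟩ := h
  have h1 := norm_sub_sq_eq_add y p q
  have h2 := h q hq
  refine le_of_sq_le_sq ?_ (norm_nonneg _) 
  have h3 : 2 * inner ℝ (y - p) (q - p) ≤ ‖q - p‖ ^ 2 := by
    rcases le_total (inner ℝ (y - p) (q - p)) 0 with h0 | h0
    · nlinarith [sq_nonneg ‖q - p‖]
    · nlinarith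
  linarith

theorem eq_of_norm_le (h : IsFootPoint M y p) (hq : q ∈ M) (hle : ‖y - q‖ ≤ ‖y - p‖) : q = p := by
  obtain ⟨-, η, hη, h⟩ := h
  have h1 := norm_sub_sq_eq_add y p q
  have h2 := h q hq
  have h3 : ‖y - q‖ ^ 2 ≤ ‖y - p‖ ^ 2 := by gcongr
  have h4 : ‖q - p‖ ^ 2 * η ≤ 0 := by nlinarith
  have h5 : ‖q - p‖ ^ 2 ≤ 0 := by nlinarith [sq_nonneg ‖q - p‖]
  rw [← sub_eq_zero, ← norm_eq_zero]
  exact pow_eq_zero_iff two_ne_zero |>.1 (le_antisymm h5 (sq_nonneg _))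

/-- The nearest point depends continuously on the point, with an explicit modulus at each foot
point. -/
theorem exists_norm_sub_le (h : IsFootPoint M x p) :
    ∃ C : ℝ, ∀ y q, q ∈ M → ‖y - q‖ ≤ ‖y - p‖ → ‖q - p‖ ≤ C * ‖y - x‖ := by
  obtain ⟨-, η, hη, h⟩ := h
  refine ⟨2 * (1 + η) / η, fun y q hq hle => ?_⟩
  have h1 := norm_sub_sq_eq_add y p q
  have h2 := h q hq
  have h3 : ‖y - q‖ ^ 2 ≤ ‖y - p‖ ^ 2 := by gcongr
  have h4 : inner ℝ (y - p) (q - p) = inner ℝ (y - x) (q - p) + inner ℝ (x - p) (q - p) := by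
    rw [← inner_add_left, sub_add_sub_cancel]
  have h5 : inner ℝ (y - x) (q - p) ≤ ‖y - x‖ * ‖q - p‖ := real_inner_le_norm _ _
  have h6 : η * ‖q - p‖ ^ 2 ≤ 2 * (1 + η) * (‖y - x‖ * ‖q - p‖) := by nlinarith
  rw [div_mul_eq_mul_div, le_div_iff₀ hη]
  rcases (norm_nonneg (q - p)).eq_or_lt with h0 | h0
  · rw [← h0, zero_mul]
    positivity
  · nlinarith

theorem dist_eq_infDist (h : IsFootPoint M y p) : dist y p = Metric.infDist y M := by
  refine le_antisymm ((Metric.le_infDist ⟨p, h.1⟩).2 fun {q} hq => ?_)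
    (Metric.infDist_le_dist_of_mem h.1)
  rw [dist_eq_norm, dist_eq_norm]
  exact h.norm_le hq

end IsFootPoint

theorem isFootPoint_self (hx : x ∈ M) : IsFootPoint M x x :=
  ⟨hx, 1, one_pos, fun q _ => by simp⟩

/-- A smooth local parametrization `g` of `M` near `p`, together with a smooth map `Ψ` on the
ambient space that restricts to its inverse. -/
theorem IsSubmanifold.exists_param {k : ℕ∞} (hM : IsSubmanifold k M) (hp : p ∈ M) :
    ∃ (V : Submodule ℝ (EuclideanSpace ℝ (Fin n))) (g : V → EuclideanSpace ℝ (Fin n)) (v₀ : V)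
      (Ψ : EuclideanSpace ℝ (Fin n) → V),
      ContDiffAt ℝ k g v₀ ∧ g v₀ = p ∧ ContDiffAt ℝ k Ψ p ∧ Ψ p = v₀ ∧ (∀ᶠ v in 𝓝 v₀, g v ∈ M) ∧
      (∀ᶠ v in 𝓝 v₀, Ψ (g v) = v) ∧ ∀ᶠ q in 𝓝 p, q ∈ M → g (Ψ q) = q := by
  obtain ⟨Φ, V, hpΦ, hΦ, hΦs, hV⟩ := hM p hp
  have hpt : Φ p ∈ Φ.target := Φ.map_source hpΦ
  have hpV : Φ p ∈ V := (hV p hpΦ).1 hp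
  have hc : Continuous (V.subtypeL : V → EuclideanSpace ℝ (Fin n)) := V.subtypeL.continuous
  have ht : ∀ᶠ v : V in 𝓝 ⟨Φ p, hpV⟩, (v : EuclideanSpace ℝ (Fin n)) ∈ Φ.target :=
    hc.continuousAt.eventually_mem (Φ.open_target.mem_nhds hpt)
  have hproj : ∀ v : V, V.orthogonalProjectionOnto (v : EuclideanSpace ℝ (Fin n)) = v :=
    fun v => V.orthogonalProjectionOnto_mem_subspace_eq_self v
  refine ⟨V, fun v => Φ.symm v, ⟨Φ p, hpV⟩, fun q => V.orthogonalProjectionOnto (Φ q),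
    ?_, ?_, ?_, ?_, ?_, ?_, ?_⟩
  · have h1 : ContDiffAt ℝ k Φ.symm (V.subtypeL ⟨Φ p, hpV⟩) :=
      hΦs.contDiffAt (Φ.open_target.mem_nhds hpt)
    exact h1.comp _ V.subtypeL.contDiff.contDiffAt
  · exact Φ.left_inv hpΦ
  · exact V.orthogonalProjectionOnto.contDiff.contDiffAt.comp p
      (hΦ.contDiffAt (Φ.open_source.mem_nhds hpΦ))
  · exact hproj ⟨Φ p, hpV⟩
  · filter_upwards [ht] with v hv
    rw [hV _ (Φ.map_target hv), Φ.right_inv hv]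
    exact v.2
  · filter_upwards [ht] with v hv
    rw [Φ.right_inv hv, hproj]
  · filter_upwards [Φ.open_source.mem_nhds hpΦ] with q hq hqM
    have h1 : Φ q ∈ V := (hV q hq).1 hqM
    have h2 := hproj ⟨Φ q, h1⟩
    rw [show V.orthogonalProjectionOnto (Φ q) = ⟨Φ q, h1⟩ from h2]
    exact Φ.left_inv hq

end

/-! ### Foot points near a submanifold -/

section
variable {n : ℕ} {M : Set (EuclideanSpace ℝ (Fin n))} {x y p q : EuclideanSpace ℝ (Fin n)}

/-- First-order condition: the segment to a nearest point is normal to every parametrized piece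
of `M`. -/
theorem inner_fderiv_eq_zero_of_isLocalMin {V : Type*} [NormedAddCommGroup V] [NormedSpace ℝ V]
    {g : V → EuclideanSpace ℝ (Fin n)} {v : V} (hg : DifferentiableAt ℝ g v)
    (h : ∀ᶠ u in 𝓝 v, ‖y - g v‖ ≤ ‖y - g u‖) (w : V) :
    inner ℝ (y - g v) (fderiv ℝ g v w) = 0 := by
  have h1 : IsLocalMin (fun u => ‖y - g u‖ ^ 2) v := by
    filter_upwards [h] with u hu
    gcongr
  have h2 := h1.hasFDerivAt_eq_zero ((hg.hasFDerivAt.const_sub y).norm_sq)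
  have h3 := DFunLike.congr_fun h2 w
  simp only [FunLike.coe_smul, Pi.smul_apply, ContinuousLinearMap.comp_apply,
    neg_apply, innerSL_apply_apply, inner_neg_right,
    zero_apply] at h3
  simpa using h3

/-- First-order Taylor estimate for a map with Lipschitz derivative. -/
theorem norm_sub_sub_fderiv_le {V F : Type*} [NormedAddCommGroup V] [NormedSpace ℝ V]
    [NormedAddCommGroup F] [NormedSpace ℝ F] {g : V → F} {s : Set V} {L : NNReal} (hs : Convex ℝ s)
    (hg : ∀ v ∈ s, DifferentiableAt ℝ g v) (hL : LipschitzOnWith L (fderiv ℝ g) s) {a b : V}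
    (ha : a ∈ s) (hb : b ∈ s) : ‖g b - g a - fderiv ℝ g a (b - a)‖ ≤ L * ‖b - a‖ ^ 2 := by
  have hseg : segment ℝ a b ⊆ s := hs.segment_subset ha hb
  have hbound : ∀ v ∈ segment ℝ a b, ‖fderiv ℝ g v - fderiv ℝ g a‖ ≤ L * ‖b - a‖ := fun v hv => by
    refine (hL.norm_sub_le (hseg hv) ha).trans ?_
    gcongr
    have h1 := (mem_segment_iff_wbtw.1 hv).dist_add_dist
    rw [dist_eq_norm', dist_eq_norm', dist_eq_norm' a b] at h1
    linarith [norm_nonneg (b - v)]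
  rw [pow_two, ← mul_assoc]
  exact (convex_segment (𝕜 := ℝ) a b).norm_image_sub_le_of_norm_hasFDerivWithin_le'
      (fun v hv => (hg v (hseg hv)).hasFDerivAt.hasFDerivWithinAt) hbound
      (left_mem_segment _ _ _) (right_mem_segment _ _ _)

/-- Chords of a `C²` submanifold make a small angle with it, locally uniformly: the component of
`q - p` along the normal vector `y - p` is at most quadratic in `‖q - p‖`. -/
theorem IsSubmanifold.exists_inner_le {k : ℕ∞} (hk : 2 ≤ k) (hM : IsSubmanifold k M)
    (hx : x ∈ M) : ∃ C : ℝ, 0 ≤ C ∧ ∃ ρ > 0, ∀ p ∈ M, dist p x < ρ → ∀ q ∈ M, dist q x < ρ →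
      ∀ y, (∀ m ∈ M, ‖y - p‖ ≤ ‖y - m‖) →
        inner ℝ (y - p) (q - p) ≤ C * ‖y - p‖ * ‖q - p‖ ^ 2 := by
  obtain ⟨V, g, v₀, Ψ, hg, hgx, hΨ, hΨx, hgM, -, hgΨ⟩ := hM.exists_param hx
  have hk2 : ((2 : ℕ∞) : WithTop ℕ∞) ≤ k := by exact_mod_cast hk
  have hk1 : ((1 : ℕ∞) : WithTop ℕ∞) ≤ k := le_trans (by norm_num) hk2
  obtain ⟨K, s, hs, hK⟩ := (hΨ.of_le hk1).exists_lipschitzOnWith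
  have hg' : ContDiffAt ℝ 1 (fderiv ℝ g) v₀ := hg.fderiv_right (le_trans (by norm_num) hk2)
  obtain ⟨L, t, ht, hL⟩ := hg'.exists_lipschitzOnWith
  have hgd : ∀ᶠ v in 𝓝 v₀, DifferentiableAt ℝ g v :=
    ((hg.of_le hk1).eventually (by simp)).mono fun v hv => hv.differentiableAt (by simp)
  obtain ⟨r, hr, hball⟩ := Metric.eventually_nhds_iff_ball.1
    ((hgd.and hgM.eventually_nhds).and (show ∀ᶠ v in 𝓝 v₀, v ∈ t from ht))
  have hΨc : ∀ᶠ q in 𝓝 x, Ψ q ∈ Metric.ball v₀ r :=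
    hΨ.continuousAt.eventually_mem (by rw [hΨx]; exact Metric.ball_mem_nhds _ hr)
  obtain ⟨ρ, hρ, hρb⟩ := Metric.eventually_nhds_iff.1
    ((hΨc.and hgΨ).and (show ∀ᶠ q in 𝓝 x, q ∈ s from hs))
  refine ⟨L * K ^ 2, by positivity, ρ, hρ, fun p hp hpx q hq hqx y hy => ?_⟩
  obtain ⟨⟨hpb, hgp⟩, hps⟩ := hρb hpx
  obtain ⟨⟨hqb, hgq⟩, hqs⟩ := hρb hqx
  have hab : ‖Ψ q - Ψ p‖ ≤ K * ‖q - p‖ := hK.norm_sub_le hqs hps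
  have htaylor : ‖g (Ψ q) - g (Ψ p) - fderiv ℝ g (Ψ p) (Ψ q - Ψ p)‖ ≤
      L * ‖Ψ q - Ψ p‖ ^ 2 :=
    norm_sub_sub_fderiv_le (convex_ball v₀ r) (fun v hv => (hball v hv).1.1)
      (hL.mono fun v hv => (hball v hv).2) hpb hqb
  have hcrit := inner_fderiv_eq_zero_of_isLocalMin (y := y) (hball _ hpb).1.1
    ((hball _ hpb).1.2.mono fun u hu => by
      rw [hgp hp]
      exact hy _ hu) (Ψ q - Ψ p)
  rw [hgp hp, hgq hq] at htaylor
  rw [hgp hp] at hcrit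
  have h1 : inner ℝ (y - p) (q - p) =
      inner ℝ (y - p) (q - p - fderiv ℝ g (Ψ p) (Ψ q - Ψ p)) := by
    rw [inner_sub_right _ (q - p), hcrit, sub_zero]
  calc inner ℝ (y - p) (q - p) ≤ ‖y - p‖ * ‖q - p - fderiv ℝ g (Ψ p) (Ψ q - Ψ p)‖ := by
        rw [h1]
        exact real_inner_le_norm _ _
    _ ≤ ‖y - p‖ * (L * (K * ‖q - p‖) ^ 2) := by
        refine mul_le_mul_of_nonneg_left (htaylor.trans ?_) (norm_nonneg _)
        gcongr
    _ = L * K ^ 2 * ‖y - p‖ * ‖q - p‖ ^ 2 := by ring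

/-- Near a closed submanifold every point has a foot point. -/
theorem IsSubmanifold.eventually_exists_isFootPoint {k : ℕ∞} (hk : 2 ≤ k) (hM : IsSubmanifold k M)
    (hclosed : IsClosed M) (hx : x ∈ M) : ∀ᶠ y in 𝓝 x, ∃ p, IsFootPoint M y p := by
  obtain ⟨C, hC, ρ, hρ, h⟩ := hM.exists_inner_le hk hx
  set τ := min (ρ / 8) (1 / (4 * (C + 1))) with hτ
  have hτ0 : 0 < τ := by positivity
  have hτ1 : τ ≤ ρ / 8 := min_le_left _ _
  have hτ2 : 4 * C * τ ≤ 1 := by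
    have h1 : τ ≤ 1 / (4 * (C + 1)) := min_le_right _ _
    rw [le_div_iff₀ (by positivity)] at h1
    nlinarith
  filter_upwards [Metric.ball_mem_nhds x hτ0] with y hy
  obtain ⟨p, hp, hpd⟩ := hclosed.exists_infDist_eq_dist ⟨x, hx⟩ y
  have hmin : ∀ m ∈ M, ‖y - p‖ ≤ ‖y - m‖ := fun m hm => by
    rw [← dist_eq_norm, ← dist_eq_norm, ← hpd]
    exact Metric.infDist_le_dist_of_mem hm
  have hyp : ‖y - p‖ ≤ τ := by
    refine (hmin x hx).trans ?_
    rw [← dist_eq_norm]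
    exact (Metric.mem_ball.1 hy).le
  have hpx : dist p x < 2 * τ := by
    have h1 := dist_triangle p y x
    rw [dist_comm p y, dist_eq_norm y p] at h1
    linarith [Metric.mem_ball.1 hy]
  refine ⟨p, hp, 1, one_pos, fun q hq => ?_⟩
  rcases lt_or_ge (dist q x) ρ with hqx | hqx
  · have h1 := h p hp (by linarith) q hq hqx y hmin
    have h2 : C * ‖y - p‖ * ‖q - p‖ ^ 2 ≤ C * τ * ‖q - p‖ ^ 2 := by gcongr
    nlinarith [sq_nonneg ‖q - p‖]
  · have h1 := real_inner_le_norm (y - p) (q - p)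
    have h2 := dist_triangle q p x
    rw [dist_eq_norm q p] at h2
    have h3 : ‖y - p‖ * ‖q - p‖ ≤ τ * ‖q - p‖ := by gcongr
    nlinarith [norm_nonneg (q - p)]

/-- Second-order condition: at a foot point the Hessian of the squared distance is definite, so
a direction `w` along which the gradient of the squared distance to `x` is stationary is killed by
the derivative of the parametrization. -/
theorem IsFootPoint.fderiv_apply_eq_zero {V : Type*} [NormedAddCommGroup V] [NormedSpace ℝ V]
    {g : V → EuclideanSpace ℝ (Fin n)} {v : V} (hg : ContDiffAt ℝ 2 g v)
    (hgM : ∀ᶠ u in 𝓝 v, g u ∈ M) (h : IsFootPoint M x (g v)) {w : V}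
    (hw : HasDerivAt (fun s : ℝ => inner ℝ (x - g (v + s • w)) (fderiv ℝ g (v + s • w) w)) 0 0) :
    fderiv ℝ g v w = 0 := by
  obtain ⟨-, η, hη, h⟩ := h
  by_contra hne
  set p := g v with hp
  have hline : ∀ s : ℝ, HasDerivAt (fun s : ℝ => v + s • w) w s := fun s => by
    simpa using ((hasDerivAt_id s).smul_const w).const_add v
  have hline0 : Tendsto (fun s : ℝ => v + s • w) (𝓝 0) (𝓝 v) := by
    have := (hline 0).continuousAt.tendsto
    simpa using this
  have hgd : ∀ᶠ s : ℝ in 𝓝 0, HasDerivAt (fun s : ℝ => g (v + s • w))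
      (fderiv ℝ g (v + s • w) w) s := by
    refine hline0.eventually (((hg.of_le (m := 1) (by norm_num)).eventually (by simp))) |>.mono
      fun s hs => ?_
    exact (hs.differentiableAt (by simp)).hasFDerivAt.comp_hasDerivAt s (hline s)
  have hH : DifferentiableAt ℝ (fun s : ℝ => fderiv ℝ g (v + s • w) w) 0 := by
    have h1 : ContDiffAt ℝ 1 (fderiv ℝ g) v := hg.fderiv_right (by norm_num)
    have h2 : DifferentiableAt ℝ (fderiv ℝ g) (v + (0 : ℝ) • w) := by
      simpa using h1.differentiableAt (by simp)
    exact (h2.comp (0 : ℝ) (hline 0).differentiableAt).clm_apply (differentiableAt_const w)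
  set f : ℝ → ℝ := fun s => ‖g (v + s • w) - p‖ ^ 2 -
    2 * (1 + η) * inner ℝ (x - p) (g (v + s • w) - p) with hf
  set a : ℝ → ℝ := fun s => inner ℝ (x - g (v + s • w)) (fderiv ℝ g (v + s • w) w) with ha
  set b : ℝ → ℝ := fun s => inner ℝ (g (v + s • w) - p) (fderiv ℝ g (v + s • w) w) with hb
  have hf0 : f 0 = 0 := by simp [hf, hp]
  have hmin : IsLocalMin f 0 := by
    filter_upwards [hline0.eventually hgM] with s hs
    rw [hf0]
    exact sub_nonneg.2 (h _ hs)
  have hfd : ∀ᶠ s in 𝓝 (0 : ℝ), HasDerivAt f (-2 * (1 + η) * a s - 2 * η * b s) s := by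
    filter_upwards [hgd] with s hs
    have h1 := ((hs.sub_const p).norm_sq).sub
      (((hasDerivAt_const s (x - p)).inner ℝ (hs.sub_const p)).const_mul (2 * (1 + η)))
    refine h1.congr_deriv ?_
    have h2 : a s = inner ℝ (x - p) (fderiv ℝ g (v + s • w) w) - b s := by
      rw [ha, hb]
      simp only
      rw [← inner_sub_left, sub_sub_sub_cancel_right]
    rw [h2]
    simp only [inner_zero_left, add_zero]
    ring
  have hderiv : deriv f =ᶠ[𝓝 0] fun s => -2 * (1 + η) * a s - 2 * η * b s :=
    hfd.mono fun s hs => hs.deriv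
  have hbd : HasDerivAt b (‖fderiv ℝ g v w‖ ^ 2) 0 := by
    have h1 := (hgd.self_of_nhds.sub_const p).inner ℝ hH.hasDerivAt
    refine h1.congr_deriv ?_
    simp [hp]
  have hdd : HasDerivAt (deriv f) (-2 * η * ‖fderiv ℝ g v w‖ ^ 2) 0 := by
    refine HasDerivAt.congr_of_eventuallyEq ?_ hderiv
    refine ((hw.const_mul (-2 * (1 + η))).sub (hbd.const_mul (2 * η))).congr_deriv ?_
    ring
  have hneg : deriv (deriv f) 0 < 0 := by
    rw [hdd.deriv]
    have : 0 < ‖fderiv ℝ g v w‖ := norm_pos_iff.2 hne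
    have : 0 < η * ‖fderiv ℝ g v w‖ ^ 2 := by positivity
    linarith
  have hmax := isLocalMax_of_deriv_deriv_neg hneg hmin.deriv_eq_zero
    hfd.self_of_nhds.continuousAt
  have hconst : f =ᶠ[𝓝 0] fun _ => 0 := by
    filter_upwards [hmin, hmax] with s h1 h2
    exact le_antisymm (h2.trans hf0.le) (hf0.ge.trans h1)
  have h1 : deriv f =ᶠ[𝓝 0] deriv fun _ => 0 := hconst.deriv
  rw [h1.deriv_eq] at hneg
  simp at hneg

end

/-! ### Smoothness of foot points and tubular neighborhoods -/

section
variable {n : ℕ} {M : Set (EuclideanSpace ℝ (Fin n))} {x y p q : EuclideanSpace ℝ (Fin n)}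

theorem one_le_sub_one {k : ℕ∞} (hk : 2 ≤ k) : 1 ≤ k - 1 := by
  refine ENat.le_sub_of_add_le_left (by simp) ?_
  rwa [one_add_one_eq_two]

theorem coe_sub_one_ne_zero {k : ℕ∞} (hk : 2 ≤ k) : ((k - 1 : ℕ∞) : WithTop ℕ∞) ≠ 0 := by
  exact_mod_cast (lt_of_lt_of_le one_pos (one_le_sub_one hk)).ne'

theorem isInvertible_of_injective_dual {V : Type*} [NormedAddCommGroup V] [NormedSpace ℝ V]
    [FiniteDimensional ℝ V] (L : V →L[ℝ] V →L[ℝ] ℝ) (hL : ∀ w, L w = 0 → w = 0) :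
    L.IsInvertible := by
  have hinj : Function.Injective (L : V →ₗ[ℝ] V →L[ℝ] ℝ) :=
    (injective_iff_map_eq_zero _).2 hL
  have hdim : Module.finrank ℝ V = Module.finrank ℝ (V →L[ℝ] ℝ) := by
    rw [← (LinearMap.toContinuousLinearMap : (V →ₗ[ℝ] ℝ) ≃ₗ[ℝ] V →L[ℝ] ℝ).finrank_eq]
    exact Subspace.dual_finrank_eq.symm
  exact ⟨(LinearEquiv.ofInjectiveOfFinrankEq _ hinj hdim).toContinuousLinearEquiv, by ext; rfl⟩

theorem hasDerivAt_partial_line {X V G : Type*} [NormedAddCommGroup X] [NormedSpace ℝ X]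
    [NormedAddCommGroup V] [NormedSpace ℝ V] [NormedAddCommGroup G] [NormedSpace ℝ G]
    {F : X × V → G} {x : X} {v w : V} (hF : DifferentiableAt ℝ F (x, v)) :
    HasDerivAt (fun s : ℝ => F (x, v + s • w)) (fderiv ℝ F (x, v) (0, w)) 0 := by
  have h2 : HasDerivAt (fun s : ℝ => (x, v + s • w)) ((0 : X), w) 0 :=
    (hasDerivAt_const _ _).prodMk
      (by simpa using ((hasDerivAt_id (0 : ℝ)).smul_const w).const_add v)
  refine HasFDerivAt.comp_hasDerivAt (0 : ℝ) ?_ h2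
  simpa using hF.hasFDerivAt

/-- The left-hand side of the equation `⟪y - g v, g' v w⟫ = 0` for all `w`, which says that the
vector from `g v` to `y` is normal to the image of the parametrization `g`. -/
noncomputable def normalEquation {V : Type*} [NormedAddCommGroup V] [NormedSpace ℝ V]
    (g : V → EuclideanSpace ℝ (Fin n)) (u : EuclideanSpace ℝ (Fin n) × V) : V →L[ℝ] ℝ :=
  (innerSL ℝ (u.1 - g u.2)).comp (fderiv ℝ g u.2)

theorem contDiffAt_normalEquation {V : Type*} [NormedAddCommGroup V] [NormedSpace ℝ V]
    {g : V → EuclideanSpace ℝ (Fin n)} {v : V} {m : WithTop ℕ∞} (hg : ContDiffAt ℝ m g v)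
    (hg' : ContDiffAt ℝ m (fderiv ℝ g) v) : ContDiffAt ℝ m (normalEquation g) (x, v) := by
  refine ContDiffAt.clm_comp ((innerSL ℝ).contDiff.contDiffAt.comp _
    (contDiffAt_fst.sub ?_)) ?_
  · exact ContDiffAt.comp (x, v) (g := g) hg contDiffAt_snd
  · exact ContDiffAt.comp (x, v) (g := fderiv ℝ g) hg' contDiffAt_snd

theorem IsFootPoint.isInvertible_normalEquation {V : Type*} [NormedAddCommGroup V]
    [NormedSpace ℝ V] [FiniteDimensional ℝ V] {g : V → EuclideanSpace ℝ (Fin n)} {v : V}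
    (h : IsFootPoint M x (g v)) (hg : ContDiffAt ℝ 2 g v) (hgM : ∀ᶠ u in 𝓝 v, g u ∈ M)
    (hinj : ∀ w, fderiv ℝ g v w = 0 → w = 0) :
    (fderiv ℝ (normalEquation g) (x, v) ∘L .inr ℝ _ V).IsInvertible := by
  have hd : DifferentiableAt ℝ (normalEquation g) (x, v) :=
    (contDiffAt_normalEquation (m := 1) (hg.of_le (by norm_num))
      (hg.fderiv_right (by norm_num))).differentiableAt (by simp)
  refine isInvertible_of_injective_dual _ fun w hw => hinj w (h.fderiv_apply_eq_zero hg hgM ?_)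
  have h5 : fderiv ℝ (normalEquation g) (x, v) (0, w) = 0 := hw
  have h1 := hasDerivAt_partial_line (w := w) hd
  rw [h5] at h1
  exact (h1.clm_apply (hasDerivAt_const _ w)).congr_deriv (by simp)

theorem fderiv_injective_of_eventually_leftInverse {V F : Type*} [NormedAddCommGroup V]
    [NormedSpace ℝ V] [NormedAddCommGroup F] [NormedSpace ℝ F] {g : V → F} {Ψ : F → V} {v : V}
    (hg : DifferentiableAt ℝ g v) (hΨ : DifferentiableAt ℝ Ψ (g v))
    (h : ∀ᶠ u in 𝓝 v, Ψ (g u) = u) {w : V} (hw : fderiv ℝ g v w = 0) : w = 0 := by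
  have h9 := (hΨ.hasFDerivAt.comp v hg.hasFDerivAt).unique
    ((hasFDerivAt_id v).congr_of_eventuallyEq h)
  have h10 := DFunLike.congr_fun h9 w
  simpa [hw] using h10.symm

/-- A selection of foot points is smooth: near its value, it solves the equation which says that
`y - g v` is normal to the image of the derivative of a parametrization `g` at `v`; the implicit
function theorem applies by the second-order condition. -/
theorem IsSubmanifold.contDiffAt_of_isFootPoint {k : ℕ∞} (hk : 2 ≤ k) (hM : IsSubmanifold k M)
    {r : EuclideanSpace ℝ (Fin n) → EuclideanSpace ℝ (Fin n)}
    (h : ∀ᶠ y in 𝓝 x, IsFootPoint M y (r y)) :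
    ContDiffAt ℝ ((k - 1 : ℕ∞) : WithTop ℕ∞) r x := by
  have hx := h.self_of_nhds
  have hrc : ContinuousAt r x := by
    obtain ⟨C, hC⟩ := hx.exists_norm_sub_le
    refine tendsto_iff_norm_sub_tendsto_zero.2 (squeeze_zero' (.of_forall fun _ => norm_nonneg _)
      (h.mono fun y hy => hC y (r y) hy.1 (hy.norm_le hx.1)) ?_)
    have : Tendsto (fun y => C * ‖y - x‖) (𝓝 x) (𝓝 (C * ‖x - x‖)) :=
      (continuous_const.mul (continuous_id.sub continuous_const).norm).continuousAt
    simpa using this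
  obtain ⟨V, g, v₀, Ψ, hg, hgx, hΨ, hΨx, hgM, hΨg, hgΨ⟩ := hM.exists_param hx.1
  have hkk : ((k - 1 : ℕ∞) : WithTop ℕ∞) + 1 = k := by
    exact_mod_cast tsub_add_cancel_of_le (le_trans (by norm_num) hk : (1 : ℕ∞) ≤ k)
  have hk2 : ((2 : ℕ∞) : WithTop ℕ∞) ≤ k := by exact_mod_cast hk
  have hle : ((k - 1 : ℕ∞) : WithTop ℕ∞) ≤ k := hkk ▸ le_self_add
  have hg' : ContDiffAt ℝ ((k - 1 : ℕ∞) : WithTop ℕ∞) (fderiv ℝ g) v₀ := hg.fderiv_right hkk.le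
  have hk1 : (1 : WithTop ℕ∞) ≤ k := le_trans (by norm_num) hk2
  have hne := coe_sub_one_ne_zero hk
  have hgd : ∀ᶠ v in 𝓝 v₀, DifferentiableAt ℝ g v :=
    ((hg.of_le hk1).eventually (by simp)).mono fun v hv => hv.differentiableAt (by simp)
  have hfoot : IsFootPoint M x (g v₀) := hgx.symm ▸ hx
  have hF := contDiffAt_normalEquation (x := x) (hg.of_le hle) hg'
  have hinv := hfoot.isInvertible_normalEquation (hg.of_le hk2) hgM fun w hw =>
    fderiv_injective_of_eventually_leftInverse hgd.self_of_nhds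
      (hgx.symm ▸ (hΨ.of_le hk1).differentiableAt (by simp)) hΨg hw
  have hzero : ∀ᶠ u : EuclideanSpace ℝ (Fin n) × V in 𝓝 (x, v₀),
      IsFootPoint M u.1 (g u.2) → normalEquation g u = 0 := by
    have h1 := (continuous_snd.tendsto (x, v₀)).eventually (hgd.and hgM.eventually_nhds)
    filter_upwards [h1] with u hu hfoot
    ext w
    exact inner_fderiv_eq_zero_of_isLocalMin hu.1 (hu.2.mono fun v hv => hfoot.norm_le hv) w
  have hlift : Tendsto (fun y => (y, Ψ (r y))) (𝓝 x) (𝓝 (x, v₀)) := by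
    refine tendsto_id.prodMk_nhds ?_
    rw [← hΨx]
    exact hΨ.continuousAt.tendsto.comp hrc
  have hF0 : normalEquation g (x, v₀) = 0 := hzero.self_of_nhds hfoot
  have hsol : ∀ᶠ y in 𝓝 x, hF.implicitFunction hne hinv y = Ψ (r y) := by
    filter_upwards [hlift.eventually hzero, hlift.eventually
      (hF.eventually_apply_eq_iff_implicitFunction hne hinv), h, hrc.eventually hgΨ]
      with y h1 h2 h3 h4
    refine h2.1 ?_
    rw [hF0]
    exact h1 (by rw [h4 h3.1]; exact h3)
  have hr : r =ᶠ[𝓝 x] fun y => g (hF.implicitFunction hne hinv y) := by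
    filter_upwards [hsol, h, hrc.eventually hgΨ] with y h1 h2 h3
    rw [h1, h3 h2.1]
  refine ContDiffAt.congr_of_eventuallyEq ?_ hr
  refine ContDiffAt.comp x (g := g) ?_ (hF.contDiffAt_implicitFunction hne hinv)
  rw [hF.implicitFunction_apply_self hne hinv]
  exact hg.of_le hle

open OMinimalStructure in
theorem exists_isTubularNeighborhood (S : OMinimalStructure) {k : ℕ∞} (hk : 2 ≤ k)
    (hclosed : IsClosed M) (hdef : S.IsDefinable M) (hM : IsSubmanifold k M) :
    ∃ (U : Set (EuclideanSpace ℝ (Fin n)))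
      (r : EuclideanSpace ℝ (Fin n) → EuclideanSpace ℝ (Fin n)),
      IsTubularNeighborhood S k M U r := by
  classical
  set r : EuclideanSpace ℝ (Fin n) → EuclideanSpace ℝ (Fin n) := fun y =>
    if h : ∃ p, IsFootPoint M y p then h.choose else y with hr
  have hfoot : ∀ y, (∃ p, IsFootPoint M y p) → IsFootPoint M y (r y) := fun y h => by
    rw [hr]
    simp only [dif_pos h]
    exact h.choose_spec
  have hdefM : S.Definable (· ∈ M) := hdef
  have hdefFoot : S.Definable fun a : EuclideanSpace ℝ (Fin n) × EuclideanSpace ℝ (Fin n) =>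
      IsFootPoint M a.1 a.2 := by
    refine (hdefM.comp (.snd .id)).and (.exists' (.and (.lt (definableMap_const_real 0) (.snd .id))
      (.forall' (.imp (hdefM.comp (.snd .id)) (.le (.mul (.mul (definableMap_const_real 2)
        (.add (definableMap_const_real 1) (.snd (.fst .id)))) (.inner ?_ ?_)) ?_)))))
    · exact .vsub (.fst (.fst (.fst .id))) (.snd (.fst (.fst .id)))
    · exact .vsub (.snd .id) (.snd (.fst (.fst .id)))
    · have h1 : S.DefinableMap fun a : ((EuclideanSpace ℝ (Fin n) × EuclideanSpace ℝ (Fin n)) × ℝ) ×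
          EuclideanSpace ℝ (Fin n) => ‖a.2 - a.1.1.2‖ :=
        .norm (.vsub (.snd .id) (.snd (.fst (.fst .id))))
      exact (h1.mul h1).congr fun a => (pow_two _).symm
  have hmem : ∀ y, y ∈ interior {y | ∃ p, IsFootPoint M y p} → IsFootPoint M y (r y) :=
    fun y hy => hfoot y (interior_subset (s := {y | ∃ p, IsFootPoint M y p}) hy)
  have hdefU : S.Definable (· ∈ interior {y | ∃ p, IsFootPoint M y p}) := by
    have h1 : S.Definable fun y : EuclideanSpace ℝ (Fin n) => ∃ ρ : ℝ, 0 < ρ ∧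
        ∀ z : EuclideanSpace ℝ (Fin n), dist z y < ρ → ∃ p, IsFootPoint M z p :=
      .exists' (.and (.lt (definableMap_const_real 0) (.snd .id)) (.forall' (.imp
        (.lt (.dist (.snd .id) (.fst (.fst .id))) (.snd (.fst .id)))
        (.exists' (hdefFoot.comp (.prodMk (.snd (.fst .id)) (.snd .id)))))))
    refine h1.congr fun y => ?_
    rw [mem_interior_iff_mem_nhds, Metric.mem_nhds_iff]
    rfl
  refine ⟨interior {y | ∃ p, IsFootPoint M y p}, r, isOpen_interior, fun y hy => ?_, hdefU, ?_,
    fun y hy => (hmem y hy).1, fun y hy => ?_, fun y hy => (hmem y hy).dist_eq_infDist,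
    fun y hy q hq hyq => ?_, fun y hy => ?_⟩
  · exact mem_interior_iff_mem_nhds.2 (hM.eventually_exists_isFootPoint hk hclosed hy)
  · rw [isDefinableMap_iff]
    refine ((hdefU.comp (.fst .id)).and hdefFoot).congr fun a => and_congr_right fun ha => ?_
    constructor
    · intro h1
      exact (hmem _ ha).eq_of_norm_le h1.1 (h1.norm_le (hmem _ ha).1)
    · intro h1
      rw [h1]
      exact hmem _ ha
  · have h1 := hfoot y ⟨y, isFootPoint_self hy⟩
    exact (isFootPoint_self hy).eq_of_norm_le h1.1 (h1.norm_le hy)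
  · refine (hmem y hy).eq_of_norm_le hq ?_
    rw [← dist_eq_norm, ← dist_eq_norm, hyq, (hmem y hy).dist_eq_infDist]
  · refine (hM.contDiffAt_of_isFootPoint hk ?_).contDiffWithinAt
    filter_upwards [isOpen_interior.mem_nhds hy] with z hz using hmem z hz

end

/-! ### Inverses of families of perturbations of the identity -/

section
variable {X : Type*} [NormedAddCommGroup X] [NormedSpace ℝ X] [CompleteSpace X]

/-- A continuous right inverse `g` of a smooth map `f` with invertible derivatives is smooth, on
domains which need not be open: the derivative of `g` is the inverse of that of `f` along `g`, so
each order of smoothness of `g` gives the next. -/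
theorem ContDiffOn.of_rightInverse {f g : X → X} {D D' : Set X} {p : ℕ∞} (hp : 1 ≤ p)
    (hf : ContDiffOn ℝ p f D) (hD : UniqueDiffOn ℝ D) (hD' : UniqueDiffOn ℝ D')
    (hg : ContinuousOn g D') (hmaps : MapsTo g D' D) (hfg : ∀ x ∈ D', f (g x) = x)
    (hinv : ∀ y ∈ D, (fderivWithin ℝ f D y).IsInvertible) : ContDiffOn ℝ p g D' := by
  have hp1 : (1 : WithTop ℕ∞) ≤ p := by exact_mod_cast hp
  have hgd : ∀ x ∈ D', HasFDerivWithinAt g (fderivWithin ℝ f D (g x)).inverse D' x := by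
    intro x hx
    obtain ⟨e, he⟩ := hinv _ (hmaps hx)
    have h1 : HasFDerivWithinAt f (e : X →L[ℝ] X) D (g x) := by
      rw [he]
      exact ((hf _ (hmaps hx)).differentiableWithinAt (by
        exact (lt_of_lt_of_le one_pos hp1).ne')).hasFDerivWithinAt
    rw [← he, ContinuousLinearMap.inverse_equiv]
    refine HasFDerivWithinAt.of_local_left_inverse ?_ h1 hx
      (eventually_nhdsWithin_of_forall hfg)
    exact tendsto_nhdsWithin_iff.2 ⟨hg x hx, eventually_nhdsWithin_of_forall hmaps⟩
  have key : ∀ m : ℕ, (m : ℕ∞) ≤ p → ContDiffOn ℝ m g D' := by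
    intro m
    induction m with
    | zero => exact fun _ => contDiffOn_zero.2 hg
    | succ m ih =>
      intro hm
      have hm' : ((m : WithTop ℕ∞)) + 1 ≤ p := by exact_mod_cast hm
      have hgm := ih (le_trans (by exact_mod_cast Nat.le_succ m) hm)
      have hfd : ContDiffOn ℝ m (fderivWithin ℝ f D) D := hf.fderivWithin hD hm'
      have h1 : ContDiffOn ℝ m (fderivWithin ℝ g D') D' := by
        have h2 : ContDiffOn ℝ m (fun x => (fderivWithin ℝ f D (g x)).inverse) D' := by
          intro x hx
          have h2 : ContDiffWithinAt ℝ m (fun x => fderivWithin ℝ f D (g x)) D' x :=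
            hfd.comp hgm hmaps x hx
          exact (hinv _ (hmaps hx)).contDiffAt_map_inverse.comp_contDiffWithinAt x h2
        exact h2.congr fun x hx => (hgd x hx).fderivWithin (hD' x hx)
      have h3 := (contDiffOn_succ_iff_fderivWithin (n := m) hD').2
        ⟨fun x hx => (hgd x hx).differentiableWithinAt, by simp, h1⟩
      exact_mod_cast h3
  rw [contDiffOn_iff_forall_nat_le]
  exact key

variable [FiniteDimensional ℝ X]

/-- Inversion of a smooth family `y ↦ y + e (t, y)` of small Lipschitz perturbations of the
identity on a ball; the inverse is smooth in the parameter as well, including at the end points of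
the parameter interval. -/
theorem exists_contDiffOn_inverse {e : ℝ × X → X} {x₀ : X} {R : ℝ} {p : ℕ∞}
    (hp : 1 ≤ p) (he : ContDiffOn ℝ p e (Icc (0 : ℝ) 1 ×ˢ Metric.ball x₀ R))
    (hlip : ∀ t ∈ Icc (0 : ℝ) 1, ∀ y ∈ Metric.ball x₀ R, ∀ z ∈ Metric.ball x₀ R,
      ‖e (t, y) - e (t, z)‖ ≤ 1 / 2 * ‖y - z‖)
    (hsmall : ∀ t ∈ Icc (0 : ℝ) 1, ∀ y ∈ Metric.ball x₀ R, ‖e (t, y)‖ ≤ R / 4) :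
    ∃ g : ℝ × X → X, ContDiffOn ℝ p g (Icc (0 : ℝ) 1 ×ˢ Metric.ball x₀ (R / 4)) ∧
      ∀ t ∈ Icc (0 : ℝ) 1, ∀ x ∈ Metric.ball x₀ (R / 4),
        g (t, x) ∈ Metric.ball x₀ R ∧ g (t, x) + e (t, g (t, x)) = x := by
  classical
  have hp1 : (1 : WithTop ℕ∞) ≤ p := by exact_mod_cast hp
  have hp0 : (p : WithTop ℕ∞) ≠ 0 := (lt_of_lt_of_le one_pos hp1).ne'
  -- the fixed point of `y ↦ x - e (t, y)` in a closed ball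
  have hex : ∀ q : ℝ × X, q ∈ Icc (0 : ℝ) 1 ×ˢ Metric.ball x₀ (R / 4) →
      ∃ y ∈ Metric.ball x₀ R, y + e (q.1, y) = q.2 := by
    rintro ⟨t, x⟩ ⟨ht, hx⟩
    have hR : 0 < R / 4 := Metric.pos_of_mem_ball hx
    have hsub : Metric.closedBall x₀ (R / 2) ⊆ Metric.ball x₀ R :=
      Metric.closedBall_subset_ball (by linarith)
    have hmaps : MapsTo (fun y => x - e (t, y)) (Metric.closedBall x₀ (R / 2))
        (Metric.closedBall x₀ (R / 2)) := by
      intro y hy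
      rw [mem_closedBall_iff_norm]
      have h1 := hsmall t ht y (hsub hy)
      have h2 := mem_ball_iff_norm.1 hx
      calc ‖x - e (t, y) - x₀‖ = ‖(x - x₀) - e (t, y)‖ := by congr 1; abel
        _ ≤ ‖x - x₀‖ + ‖e (t, y)‖ := norm_sub_le _ _
        _ ≤ R / 2 := by linarith
    have hcontr : ContractingWith (1 / 2) (hmaps.restrict _ _ _) := by
      refine ⟨by rw [← NNReal.coe_lt_coe]; norm_num, LipschitzWith.of_dist_le_mul ?_⟩
      rintro ⟨y, hy⟩ ⟨z, hz⟩
      rw [Subtype.dist_eq, Subtype.dist_eq, dist_eq_norm, dist_eq_norm]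
      have h1 := hlip t ht z (hsub hz) y (hsub hy)
      rw [norm_sub_rev z y] at h1
      simpa using h1
    obtain ⟨y, hy, hfix, -⟩ := hcontr.exists_fixedPoint' Metric.isClosed_closedBall.isComplete
      hmaps (Metric.mem_closedBall_self (by linarith)) (edist_ne_top _ _)
    refine ⟨y, hsub hy, ?_⟩
    have h1 : x - e (t, y) = y := hfix
    change y + e (t, y) = x
    rw [← h1]
    nth_rewrite 2 [h1]
    abel
  choose! g hgmem hg using hex
  have hmaps : MapsTo (fun q : ℝ × X => (q.1, g q)) (Icc (0 : ℝ) 1 ×ˢ Metric.ball x₀ (R / 4))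
      (Icc (0 : ℝ) 1 ×ˢ Metric.ball x₀ R) := fun q hq => ⟨hq.1, hgmem q hq⟩
  have huniq : ∀ ρ : ℝ, UniqueDiffOn ℝ (Icc (0 : ℝ) 1 ×ˢ Metric.ball x₀ ρ) := fun ρ =>
    (uniqueDiffOn_Icc one_pos).prod Metric.isOpen_ball.uniqueDiffOn
  have hgcont : ContinuousOn g (Icc (0 : ℝ) 1 ×ˢ Metric.ball x₀ (R / 4)) := by
    intro q₀ hq₀
    have hbound : ∀ q ∈ Icc (0 : ℝ) 1 ×ˢ Metric.ball x₀ (R / 4),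
        ‖g q - g q₀‖ ≤ 2 * (‖q.2 - q₀.2‖ + ‖e (q.1, g q₀) - e (q₀.1, g q₀)‖) := by
      intro q hq
      have h1 := hlip q.1 hq.1 (g q) (hgmem q hq) (g q₀) (hgmem q₀ hq₀)
      have h2 : g q - g q₀ = (q.2 - q₀.2) - (e (q.1, g q) - e (q.1, g q₀)) -
          (e (q.1, g q₀) - e (q₀.1, g q₀)) := by
        rw [← hg q hq, ← hg q₀ hq₀]
        abel
      have h3 : ‖g q - g q₀‖ ≤ ‖q.2 - q₀.2‖ + ‖e (q.1, g q) - e (q.1, g q₀)‖ +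
          ‖e (q.1, g q₀) - e (q₀.1, g q₀)‖ := by
        rw [h2]
        exact (norm_sub_le _ _).trans (by gcongr; exact norm_sub_le _ _)
      linarith
    refine tendsto_iff_norm_sub_tendsto_zero.2 (squeeze_zero' (.of_forall fun _ => norm_nonneg _)
      (eventually_nhdsWithin_of_forall hbound) ?_)
    have h1 : ContinuousWithinAt (fun q : ℝ × X => e (q.1, g q₀))
        (Icc (0 : ℝ) 1 ×ˢ Metric.ball x₀ (R / 4)) q₀ := by
      have h2 : ContinuousOn (fun q : ℝ × X => e (q.1, g q₀))
          (Icc (0 : ℝ) 1 ×ˢ Metric.ball x₀ (R / 4)) :=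
        he.continuousOn.comp (by fun_prop) fun q hq => ⟨hq.1, hgmem q₀ hq₀⟩
      exact h2 q₀ hq₀
    have h3 : ContinuousWithinAt (fun q : ℝ × X => 2 * (‖q.2 - q₀.2‖ +
        ‖e (q.1, g q₀) - e (q₀.1, g q₀)‖)) (Icc (0 : ℝ) 1 ×ˢ Metric.ball x₀ (R / 4)) q₀ :=
      continuousWithinAt_const.mul
        ((continuous_snd.sub continuous_const).norm.continuousWithinAt.add
          (h1.sub continuousWithinAt_const).norm)
    simpa using h3.tendsto
  have hinv : ∀ q ∈ Icc (0 : ℝ) 1 ×ˢ Metric.ball x₀ R,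
      (fderivWithin ℝ (fun q : ℝ × X => (q.1, q.2 + e q)) (Icc (0 : ℝ) 1 ×ˢ Metric.ball x₀ R)
        q).IsInvertible := by
    rintro ⟨t, y⟩ hq
    obtain ⟨ht, hy⟩ := hq
    have hed := ((he (t, y) ⟨ht, hy⟩).differentiableWithinAt hp0).hasFDerivWithinAt
    set e' := fderivWithin ℝ e (Icc (0 : ℝ) 1 ×ˢ Metric.ball x₀ R) (t, y)
    have hF : HasFDerivWithinAt (fun q : ℝ × X => (q.1, q.2 + e q))
        ((ContinuousLinearMap.fst ℝ ℝ X).prod (ContinuousLinearMap.snd ℝ ℝ X + e'))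
        (Icc (0 : ℝ) 1 ×ˢ Metric.ball x₀ R) (t, y) :=
      hasFDerivWithinAt_fst.prodMk (hasFDerivWithinAt_snd.add hed)
    rw [hF.fderivWithin (huniq R _ ⟨ht, hy⟩)]
    have hpart : HasFDerivAt (fun z => e (t, z)) (e'.comp (.inr ℝ ℝ X)) y := by
      have h1 : HasFDerivWithinAt (fun z => e (t, z)) (e'.comp (.inr ℝ ℝ X))
          (Metric.ball x₀ R) y :=
        HasFDerivWithinAt.comp y hed (hasFDerivAt_prodMk_right t y).hasFDerivWithinAt
          fun z hz => ⟨ht, hz⟩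
      exact h1.hasFDerivAt (Metric.isOpen_ball.mem_nhds hy)
    have hnorm : ‖e'.comp (.inr ℝ ℝ X)‖ ≤ 1 / 2 := by
      refine hpart.le_of_lip' (by norm_num) ?_
      filter_upwards [Metric.isOpen_ball.mem_nhds hy] with z hz using hlip t ht z hz y hy
    have hinj : Function.Injective ((((ContinuousLinearMap.fst ℝ ℝ X).prod
        (ContinuousLinearMap.snd ℝ ℝ X + e')) : ℝ × X →L[ℝ] ℝ × X) : ℝ × X →ₗ[ℝ] ℝ × X) := by
      refine (injective_iff_map_eq_zero _).2 ?_
      rintro ⟨s, w⟩ h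
      have h1 : s = 0 := congrArg Prod.fst h
      have h2 : w + e' (s, w) = 0 := congrArg Prod.snd h
      subst h1
      have h3 : ‖e' (0, w)‖ ≤ 1 / 2 * ‖w‖ := (e'.comp (.inr ℝ ℝ X)).le_of_opNorm_le hnorm w
      have h4 : w = - e' (0, w) := eq_neg_of_add_eq_zero_left h2
      have h5 : ‖w‖ = ‖e' (0, w)‖ := by
        conv_lhs => rw [h4]
        exact norm_neg _
      have h6 : ‖w‖ = 0 := by linarith [norm_nonneg w]
      rw [norm_eq_zero.1 h6]
      rfl
    exact ⟨(LinearEquiv.ofInjectiveEndo _ hinj).toContinuousLinearEquiv, by ext <;> rfl⟩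
  refine ⟨g, ?_, fun t ht x hx => ⟨hgmem (t, x) ⟨ht, hx⟩, hg (t, x) ⟨ht, hx⟩⟩⟩
  have hF : ContDiffOn ℝ p (fun q : ℝ × X => (q.1, q.2 + e q))
      (Icc (0 : ℝ) 1 ×ˢ Metric.ball x₀ R) :=
    contDiffOn_fst.prodMk (contDiffOn_snd.add he)
  have h1 := ContDiffOn.of_rightInverse hp hF (huniq R) (huniq (R / 4))
    (continuousOn_fst.prodMk hgcont) hmaps (fun q hq => Prod.ext rfl (hg q hq)) hinv
  exact contDiff_snd.comp_contDiffOn h1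

end

/-! ### The control radius -/

section
variable {n : ℕ} {M U : Set (EuclideanSpace ℝ (Fin n))}
  {r : EuclideanSpace ℝ (Fin n) → EuclideanSpace ℝ (Fin n)} {ε : EuclideanSpace ℝ (Fin n) → ℝ}
  {x y : EuclideanSpace ℝ (Fin n)} {ρ ρ' : ℝ}

/-- On the ball of radius `ρ` around `x`, which lies in `U`, the retraction `r` is `3`-Lipschitz and
its derivative oscillates by at most `e / 64`, where `e` lies between `ρ` and `1` and is a lower
bound of `ε` on the part of `M` in the ball. The oscillation is expressed by second differences, so
that the condition is of first order in the graphs of `r` and `ε`. -/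
def IsControlled (M U : Set (EuclideanSpace ℝ (Fin n)))
    (r : EuclideanSpace ℝ (Fin n) → EuclideanSpace ℝ (Fin n)) (ε : EuclideanSpace ℝ (Fin n) → ℝ)
    (x : EuclideanSpace ℝ (Fin n)) (ρ : ℝ) : Prop :=
  ∃ e : ℝ, 0 < e ∧ e ≤ 1 ∧ ρ ≤ e ∧ (∀ y, dist y x < ρ → y ∈ U ∧ (y ∈ M → e ≤ ε y)) ∧
    (∀ y, dist y x < ρ → ∀ z, dist z x < ρ → ‖r y - r z‖ ≤ 3 * ‖y - z‖) ∧
    ∀ y, dist y x < ρ → ∀ z, dist z x < ρ → ∀ v, dist (y + v) x < ρ → dist (z + v) x < ρ →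
      ‖r (y + v) - r y - (r (z + v) - r z)‖ ≤ e / 64 * ‖v‖

theorem IsControlled.mono (h : IsControlled M U r ε x ρ) (hle : dist y x + ρ' ≤ ρ) :
    IsControlled M U r ε y ρ' := by
  obtain ⟨e, he0, he1, hρe, hU, hlip, hosc⟩ := h
  have hb : ∀ {z}, dist z y < ρ' → dist z x < ρ := fun {z} hz => by
    linarith [dist_triangle z y x]
  exact ⟨e, he0, he1, by linarith [dist_nonneg (x := y) (y := x)], fun z hz => hU z (hb hz),
    fun z hz w hw => hlip z (hb hz) w (hb hw),
    fun z hz w hw v hv hv' => hosc z (hb hz) w (hb hw) v (hb hv) (hb hv')⟩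

theorem IsControlled.congr {r' : EuclideanSpace ℝ (Fin n) → EuclideanSpace ℝ (Fin n)}
    {ε' : EuclideanSpace ℝ (Fin n) → ℝ} (h : IsControlled M U r ε x ρ) (hr : EqOn r r' U)
    (hε : EqOn ε ε' M) : IsControlled M U r' ε' x ρ := by
  obtain ⟨e, he0, he1, hρe, hU, hlip, hosc⟩ := h
  refine ⟨e, he0, he1, hρe, fun y hy => ⟨(hU y hy).1, fun hyM => ?_⟩, fun y hy z hz => ?_,
    fun y hy z hz v hv hv' => ?_⟩
  · rw [← hε hyM]
    exact (hU y hy).2 hyM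
  · rw [← hr (hU y hy).1, ← hr (hU z hz).1]
    exact hlip y hy z hz
  · rw [← hr (hU y hy).1, ← hr (hU z hz).1, ← hr (hU _ hv).1, ← hr (hU _ hv').1]
    exact hosc y hy z hz v hv hv'

open OMinimalStructure in
theorem definable_isControlled {S : OMinimalStructure} (hM : S.Definable (· ∈ M))
    (hU : S.Definable (· ∈ U)) (hr : S.DefinableMap r) (hε : S.DefinableMap ε) :
    S.Definable fun p : EuclideanSpace ℝ (Fin n) × ℝ => IsControlled M U r ε p.1 p.2 := by
  refine .exists' (.and (.lt (definableMap_const_real 0) (.snd .id)) (.and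
    (.le (.snd .id) (definableMap_const_real 1)) (.and (.le (.snd (.fst .id)) (.snd .id))
    (.and (.forall' (.imp ?_ (.and (hU.comp (.snd .id)) (.imp (hM.comp (.snd .id)) ?_))))
    (.and (.forall' (.imp ?_ (.forall' (.imp ?_ ?_)))) (.forall' (.imp ?_ (.forall' (.imp ?_
      (.forall' (.imp ?_ (.imp ?_ ?_))))))))))))
  · exact .lt (.dist (.snd .id) (.fst (.fst (.fst .id)))) (.snd (.fst (.fst .id)))
  · exact .le (.snd (.fst .id)) (hε.comp (.snd .id))
  · exact .lt (.dist (.snd .id) (.fst (.fst (.fst .id)))) (.snd (.fst (.fst .id)))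
  · exact .lt (.dist (.snd .id) (.fst (.fst (.fst (.fst .id))))) (.snd (.fst (.fst (.fst .id))))
  · exact .le (.norm (.vsub (hr.comp (.snd (.fst .id))) (hr.comp (.snd .id))))
      (.mul (definableMap_const_real 3) (.norm (.vsub (.snd (.fst .id)) (.snd .id))))
  · exact .lt (.dist (.snd .id) (.fst (.fst (.fst .id)))) (.snd (.fst (.fst .id)))
  · exact .lt (.dist (.snd .id) (.fst (.fst (.fst (.fst .id))))) (.snd (.fst (.fst (.fst .id))))
  · exact .lt (.dist (.vadd (.snd (.fst (.fst .id))) (.snd .id))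
      (.fst (.fst (.fst (.fst (.fst .id)))))) (.snd (.fst (.fst (.fst (.fst .id)))))
  · exact .lt (.dist (.vadd (.snd (.fst .id)) (.snd .id))
      (.fst (.fst (.fst (.fst (.fst .id)))))) (.snd (.fst (.fst (.fst (.fst .id)))))
  · exact .le (.norm (.vsub
      (.vsub (hr.comp (.vadd (.snd (.fst (.fst .id))) (.snd .id)))
        (hr.comp (.snd (.fst (.fst .id)))))
      (.vsub (hr.comp (.vadd (.snd (.fst .id)) (.snd .id))) (hr.comp (.snd (.fst .id))))))
      (.mul (.mul (.snd (.fst (.fst (.fst .id)))) (definableMap_const_real 64⁻¹))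
        (.norm (.snd .id)))

namespace IsTubularNeighborhood

variable {S : OMinimalStructure} {k : ℕ∞}

theorem norm_sub_le (h : IsTubularNeighborhood S k M U r) (hx : x ∈ M) (hy : y ∈ U) :
    ‖y - r y‖ ≤ ‖y - x‖ := by
  rw [← dist_eq_norm, h.dist_eq y hy, ← dist_eq_norm]
  exact Metric.infDist_le_dist_of_mem hx

theorem differentiableAt (h : IsTubularNeighborhood S k M U r) (hk : 2 ≤ k) (hx : x ∈ U) :
    DifferentiableAt ℝ r x := by
  exact (h.contDiffOn.differentiableOn (coe_sub_one_ne_zero hk) x hx).differentiableAt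
    (h.isOpen.mem_nhds hx)

theorem exists_isControlled (h : IsTubularNeighborhood S k M U r) (hk : 2 ≤ k)
    (hε : ContinuousOn ε M) (hpos : ∀ x ∈ M, 0 < ε x) (hx : x ∈ M) :
    ∃ ρ > 0, IsControlled M U r ε x ρ := by
  have hxU := h.subset hx
  have hd : ContDiffAt ℝ ((k - 1 : ℕ∞) : WithTop ℕ∞) r x :=
    h.contDiffOn.contDiffAt (h.isOpen.mem_nhds hxU)
  have hstrict := hd.hasStrictFDerivAt (coe_sub_one_ne_zero hk)
  set A := fderiv ℝ r x
  have hA : ‖A‖ ≤ 2 := by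
    -- `r y` is no farther from `y` than `x` is, so `‖r y - x‖ ≤ 2 * ‖y - x‖`
    refine hstrict.hasFDerivAt.le_of_lip' (by norm_num) ?_
    filter_upwards [h.isOpen.mem_nhds hxU] with y hy
    rw [h.retraction x hx]
    have h1 := h.norm_sub_le hx hy
    have h2 : r y - x = (y - x) - (y - r y) := by abel
    rw [h2]
    linarith [_root_.norm_sub_le (y - x) (y - r y)]
  set e := min (ε x / 2) 1 with he
  have hεx := hpos x hx
  have he0 : 0 < e := lt_min (by linarith) one_pos
  have hc : 0 < e / 128 := by positivity
  obtain ⟨s, hs, happrox⟩ := hstrict.approximates_deriv_on_nhds (c := ⟨e / 128, hc.le⟩)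
    (.inr (by exact hc))
  have happ : ∀ y ∈ s, ∀ z ∈ s, ‖r y - r z - A (y - z)‖ ≤ e / 128 * ‖y - z‖ :=
    fun y hy z hz => happrox y hy z hz
  have hεev : ∀ᶠ y in 𝓝 x, y ∈ M → e ≤ ε y := by
    have h1 := (hε x hx).eventually (lt_mem_nhds (show ε x / 2 < ε x by linarith))
    filter_upwards [eventually_nhdsWithin_iff.1 h1] with y hy hyM
    exact (min_le_left _ _).trans (hy hyM).le
  obtain ⟨ρ₀, hρ₀, hball⟩ := Metric.eventually_nhds_iff.1
    (((show ∀ᶠ y in 𝓝 x, y ∈ s from hs).and (h.isOpen.mem_nhds hxU)).and hεev)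
  refine ⟨min ρ₀ e, lt_min hρ₀ he0, e, he0, min_le_right _ _, min_le_right _ _,
    fun y hy => ?_, fun y hy z hz => ?_, fun y hy z hz v hv hv' => ?_⟩
  · have h1 := hball (hy.trans_le (min_le_left _ _))
    exact ⟨h1.1.2, h1.2⟩
  · have h1 := happ y (hball (hy.trans_le (min_le_left _ _))).1.1 z
      (hball (hz.trans_le (min_le_left _ _))).1.1
    have h2 := A.le_of_opNorm_le hA (y - z)
    have h3 : ‖r y - r z‖ ≤ ‖r y - r z - A (y - z)‖ + ‖A (y - z)‖ := by
      simpa using norm_add_le (r y - r z - A (y - z)) (A (y - z))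
    have h4 : e ≤ 1 := min_le_right _ _
    nlinarith [norm_nonneg (y - z)]
  · have h1 := happ _ (hball (hv.trans_le (min_le_left _ _))).1.1 y
      (hball (hy.trans_le (min_le_left _ _))).1.1
    have h2 := happ _ (hball (hv'.trans_le (min_le_left _ _))).1.1 z
      (hball (hz.trans_le (min_le_left _ _))).1.1
    rw [add_sub_cancel_left] at h1 h2
    have h3 : r (y + v) - r y - (r (z + v) - r z) =
        (r (y + v) - r y - A v) - (r (z + v) - r z - A v) := by abel
    rw [h3]
    linarith [_root_.norm_sub_le (r (y + v) - r y - A v) (r (z + v) - r z - A v)]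

end IsTubularNeighborhood

/-- The supremum of the radii of the balls around `x` on which the retraction is controlled. -/
noncomputable def controlRadius (M U : Set (EuclideanSpace ℝ (Fin n)))
    (r : EuclideanSpace ℝ (Fin n) → EuclideanSpace ℝ (Fin n)) (ε : EuclideanSpace ℝ (Fin n) → ℝ)
    (x : EuclideanSpace ℝ (Fin n)) : ℝ :=
  sSup {ρ | 0 < ρ ∧ IsControlled M U r ε x ρ}

theorem IsControlled.le_one (h : IsControlled M U r ε x ρ) : ρ ≤ 1 := by
  obtain ⟨e, -, he1, hρe, -⟩ := h
  exact hρe.trans he1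

theorem isLUB_controlRadius (h : ∃ ρ > 0, IsControlled M U r ε x ρ) :
    IsLUB {ρ | 0 < ρ ∧ IsControlled M U r ε x ρ} (controlRadius M U r ε x) := by
  obtain ⟨ρ, h0, h1⟩ := h
  exact isLUB_csSup ⟨ρ, h0, h1⟩ ⟨1, fun ρ h => h.2.le_one⟩

theorem controlRadius_pos (h : ∃ ρ > 0, IsControlled M U r ε x ρ) :
    0 < controlRadius M U r ε x := by
  obtain ⟨ρ, h0, h1⟩ := h
  exact h0.trans_le ((isLUB_controlRadius ⟨ρ, h0, h1⟩).1 ⟨h0, h1⟩)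

theorem isControlled_of_lt_controlRadius (h : ∃ ρ > 0, IsControlled M U r ε x ρ)
    (hρ : ρ < controlRadius M U r ε x) : IsControlled M U r ε x ρ := by
  obtain ⟨ρ', ⟨-, h1⟩, h2, -⟩ := (isLUB_controlRadius h).exists_between hρ
  exact h1.mono (by simpa using h2.le)

theorem controlRadius_le_add_dist (hx : ∃ ρ > 0, IsControlled M U r ε x ρ)
    (hy : ∃ ρ > 0, IsControlled M U r ε y ρ) :
    controlRadius M U r ε y ≤ controlRadius M U r ε x + dist x y := by
  refine (isLUB_controlRadius hy).2 fun ρ hρ => ?_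
  by_cases h0 : ρ ≤ dist x y
  · linarith [controlRadius_pos hx]
  · have := (isLUB_controlRadius hx).1 ⟨sub_pos.2 (not_le.1 h0),
      hρ.2.mono (y := x) (ρ' := ρ - dist x y) (by linarith)⟩
    linarith

open OMinimalStructure in
theorem IsTubularNeighborhood.isPosDefinable_controlRadius {S : OMinimalStructure} {k : ℕ∞}
    (h : IsTubularNeighborhood S k M U r) (hk : 2 ≤ k) (hdef : S.IsDefinable M)
    (hε : S.IsPosDefinable M ε) {c : ℝ} (hc : 0 < c) :
    S.IsPosDefinable M fun x => controlRadius M U r ε x / c := by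
  classical
  have hex : ∀ x ∈ M, ∃ ρ > 0, IsControlled M U r ε x ρ := fun x hx =>
    h.exists_isControlled hk hε.continuousOn hε.pos hx
  have hdefM : S.Definable (· ∈ M) := hdef
  have hdefU : S.Definable (· ∈ U) := h.definable_nhd
  refine ⟨?_, ?_, fun x hx => div_pos (controlRadius_pos (hex x hx)) hc⟩
  · have hC : S.Definable fun p : EuclideanSpace ℝ (Fin n) × ℝ => IsControlled M U r ε p.1 p.2 := by
      have hr' := DefinableMap.ite_const hdefU (isDefinableMap_iff.1 h.definable_map)
        (DefinableMap.const_euclidean 0)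
      have hε' := DefinableMap.ite_const hdefM (isDefinableFun_iff.1 hε.definable)
        (definableMap_const_real 0)
      have hrE : EqOn r (fun a => if a ∈ U then r a else 0) U := fun a ha => (if_pos ha).symm
      have hεE : EqOn ε (fun a => if a ∈ M then ε a else 0) M := fun a ha => (if_pos ha).symm
      exact (definable_isControlled hdefM hdefU hr' hε').congr fun p =>
        ⟨fun h => h.congr hrE.symm hεE.symm, fun h => h.congr hrE hεE⟩
    have hub : S.Definable fun p : EuclideanSpace ℝ (Fin n) × ℝ =>
        ∀ ρ, 0 < ρ ∧ IsControlled M U r ε p.1 ρ → ρ ≤ p.2 :=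
      .forall' (.imp (.and (.lt (definableMap_const_real 0) (.snd .id))
        (hC.comp (.prodMk (.fst (.fst .id)) (.snd .id)))) (.le (.snd .id) (.snd (.fst .id))))
    have hlub : S.Definable fun p : EuclideanSpace ℝ (Fin n) × ℝ => p.1 ∈ M ∧
        (∀ ρ, 0 < ρ ∧ IsControlled M U r ε p.1 ρ → ρ ≤ p.2) ∧
        ∀ d, (∀ ρ, 0 < ρ ∧ IsControlled M U r ε p.1 ρ → ρ ≤ d) → p.2 ≤ d :=
      .and (hdefM.comp (.fst .id)) (.and hub (.forall' (.imp
        (hub.comp (.prodMk (.fst (.fst .id)) (.snd .id))) (.le (.snd (.fst .id)) (.snd .id)))))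
    rw [isDefinableFun_iff]
    refine (hlub.comp (f := fun p : EuclideanSpace ℝ (Fin n) × ℝ => (p.1, c * p.2))
      (.prodMk (.fst .id) (.mul (definableMap_const_real c) (.snd .id)))).congr fun p =>
        and_congr_right fun hp => ?_
    rw [eq_div_iff hc.ne', mul_comm]
    constructor
    · rintro ⟨h1, h2⟩
      exact IsLUB.unique (s := {ρ | 0 < ρ ∧ IsControlled M U r ε p.1 ρ})
        ⟨fun ρ hρ => h1 ρ hρ, fun d hd => h2 d fun ρ hρ => hd hρ⟩ (isLUB_controlRadius (hex _ hp))
    · intro h1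
      have h2 := isLUB_controlRadius (hex _ hp)
      rw [← h1] at h2
      exact ⟨fun ρ hρ => h2.1 hρ, fun d hd => h2.2 fun ρ hρ => hd ρ hρ⟩
  · refine ContinuousOn.div_const (LipschitzOnWith.continuousOn (K := 1)
      (LipschitzOnWith.of_dist_le_mul fun x hx y hy => ?_)) c
    rw [Real.dist_eq, NNReal.coe_one, one_mul, abs_sub_le_iff]
    have h1 := controlRadius_le_add_dist (hex x hx) (hex y hy)
    have h2 := controlRadius_le_add_dist (hex y hy) (hex x hx)
    rw [dist_comm y x] at h2
    constructor <;> linarith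

end

/-! ### Trivializations close to the identity -/

section
variable {n : ℕ} {M U : Set (EuclideanSpace ℝ (Fin n))}
  {r : EuclideanSpace ℝ (Fin n) → EuclideanSpace ℝ (Fin n)} {ε : EuclideanSpace ℝ (Fin n) → ℝ}
  {x y : EuclideanSpace ℝ (Fin n)} {ρ : ℝ}

theorem IsControlled.mem (h : IsControlled M U r ε x ρ) (hy : dist y x < ρ) : y ∈ U := by
  obtain ⟨e, -, -, -, hU, -⟩ := h
  exact (hU y hy).1

theorem IsControlled.norm_fderiv_le (h : IsControlled M U r ε x ρ) (hy : dist y x < ρ) :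
    ‖fderiv ℝ r y‖ ≤ 3 := by
  obtain ⟨e, -, -, -, -, hlip, -⟩ := h
  refine norm_fderiv_le_of_lip' ℝ (by norm_num) ?_
  filter_upwards [Metric.isOpen_ball.mem_nhds (show y ∈ Metric.ball x ρ from hy)] with z hz
  exact hlip z hz y hy

/-- The condition on second differences bounds the oscillation of the derivative. -/
theorem norm_fderiv_sub_fderiv_le {c : ℝ} (hc : 0 ≤ c)
    (hosc : ∀ y, dist y x < ρ → ∀ z, dist z x < ρ → ∀ v, dist (y + v) x < ρ → dist (z + v) x < ρ →
      ‖r (y + v) - r y - (r (z + v) - r z)‖ ≤ c * ‖v‖) {y z : EuclideanSpace ℝ (Fin n)}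
    (hy : dist y x < ρ) (hz : dist z x < ρ) (hry : DifferentiableAt ℝ r y)
    (hrz : DifferentiableAt ℝ r z) : ‖fderiv ℝ r y - fderiv ℝ r z‖ ≤ c := by
  have h1 : ∀ w, DifferentiableAt ℝ r w → HasFDerivAt (fun v => r (w + v)) (fderiv ℝ r w) 0 :=
    fun w hw => by
      have h2 : HasFDerivAt r (fderiv ℝ r w) (w + 0) := by simpa using hw.hasFDerivAt
      have h3 := h2.comp (0 : EuclideanSpace ℝ (Fin n)) ((hasFDerivAt_id _).const_add w)
      rw [ContinuousLinearMap.comp_id] at h3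
      exact h3
  refine ((h1 y hry).sub (h1 z hrz)).le_of_lip' hc ?_
  have h2 : ∀ w, dist w x < ρ → ∀ᶠ v in 𝓝 (0 : EuclideanSpace ℝ (Fin n)), dist (w + v) x < ρ :=
    fun w hw => by
      have : Tendsto (fun v => dist (w + v) x) (𝓝 0) (𝓝 (dist (w + 0) x)) :=
        (by fun_prop : Continuous fun v => dist (w + v) x).tendsto 0
      rw [add_zero] at this
      exact this.eventually (gt_mem_nhds hw)
  filter_upwards [h2 y hy, h2 z hz] with v hv hv'
  have h3 := hosc y hy z hz v hv hv'
  have h4 : r (y + v) - r (z + v) - (r (y + 0) - r (z + 0)) =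
      r (y + v) - r y - (r (z + v) - r z) := by
    rw [add_zero, add_zero]
    abel
  rw [sub_zero]
  rw [← h4] at h3
  exact h3

theorem smul_mem_tangentVectors {u : EuclideanSpace ℝ (Fin n)} (hu : u ∈ tangentVectors M x)
    (c : ℝ) : c • u ∈ tangentVectors M x := by
  obtain ⟨γ, h0, hM, hd⟩ := hu
  have hc : HasDerivAt (fun s : ℝ => c * s) c 0 := by
    simpa using (hasDerivAt_id (0 : ℝ)).const_mul c
  refine ⟨fun s => γ (c * s), by simpa using h0, ?_, ?_⟩
  · have h1 := hc.continuousAt.tendsto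
    simp only [mul_zero] at h1
    exact h1.eventually hM
  · have hd' : HasDerivAt γ u (c * 0) := by simpa using hd
    exact hd'.scomp (0 : ℝ) hc

namespace IsTubularNeighborhood

variable {S : OMinimalStructure} {k : ℕ∞}

theorem fderiv_mem_tangentVectors (h : IsTubularNeighborhood S k M U r) (hk : 2 ≤ k) (hy : y ∈ U)
    (w : EuclideanSpace ℝ (Fin n)) : fderiv ℝ r y w ∈ tangentVectors M (r y) := by
  have hline : HasDerivAt (fun s : ℝ => y + s • w) w 0 := by
    simpa using ((hasDerivAt_id (0 : ℝ)).smul_const w).const_add y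
  refine ⟨fun s => r (y + s • w), by simp, ?_, ?_⟩
  · have h1 := hline.continuousAt.tendsto
    simp only [zero_smul, add_zero] at h1
    filter_upwards [h1.eventually (h.isOpen.mem_nhds hy)] with s hs using h.mapsTo hs
  · refine HasFDerivAt.comp_hasDerivAt (0 : ℝ) ?_ hline
    simpa using (h.differentiableAt hk hy).hasFDerivAt

theorem fderiv_tangentVector (h : IsTubularNeighborhood S k M U r) (hk : 2 ≤ k) (hx : x ∈ M)
    {u : EuclideanSpace ℝ (Fin n)} (hu : u ∈ tangentVectors M x) : fderiv ℝ r x u = u := by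
  obtain ⟨γ, rfl, hM, hd⟩ := hu
  have h1 := (h.differentiableAt hk (h.subset hx)).hasFDerivAt.comp_hasDerivAt (0 : ℝ) hd
  refine h1.unique (hd.congr_of_eventuallyEq ?_)
  filter_upwards [hM] with s hs using h.retraction _ hs

end IsTubularNeighborhood

/-- A trivialization `ψ` that is close to the identity at the scale of the control radius. The
factor `1024` keeps the displacements well inside the balls on which `r` is controlled, and below
the values of `ε` there. -/
structure IsControlledTrivialization (S : OMinimalStructure) (k : ℕ∞)
    (M U : Set (EuclideanSpace ℝ (Fin n)))
    (r : EuclideanSpace ℝ (Fin n) → EuclideanSpace ℝ (Fin n)) (ε : EuclideanSpace ℝ (Fin n) → ℝ)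
    (Z : ℝ → Set (EuclideanSpace ℝ (Fin n)))
    (ψ : ℝ → EuclideanSpace ℝ (Fin n) → EuclideanSpace ℝ (Fin n)) : Prop where
  two_le : 2 ≤ k
  tubular : IsTubularNeighborhood S k M U r
  exists_isControlled : ∀ x ∈ M, ∃ ρ > 0, IsControlled M U r ε x ρ
  trivialization : IsTrivialization (k - 1) (fun x => controlRadius M U r ε x / 1024) M Z ψ

namespace IsControlledTrivialization

variable {S : OMinimalStructure} {k : ℕ∞} {Z : ℝ → Set (EuclideanSpace ℝ (Fin n))}
  {ψ : ℝ → EuclideanSpace ℝ (Fin n) → EuclideanSpace ℝ (Fin n)} {t : ℝ}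

variable (h : IsControlledTrivialization S k M U r ε Z ψ)
include h

theorem isControlled (hx : x ∈ M) : IsControlled M U r ε x (controlRadius M U r ε x / 2) := by
  have h1 := controlRadius_pos (h.exists_isControlled x hx)
  exact isControlled_of_lt_controlRadius (h.exists_isControlled x hx) (by linarith)

theorem dist_lt (ht : t ∈ Icc (0 : ℝ) 1) (hx : x ∈ M) :
    dist (ψ t x) x < controlRadius M U r ε x / 1024 := by
  rw [dist_comm, dist_eq_norm]
  exact h.trivialization.close t ht x hx

theorem mem_U (ht : t ∈ Icc (0 : ℝ) 1) (hx : x ∈ M) : ψ t x ∈ U := by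
  refine (h.isControlled hx).mem ((h.dist_lt ht hx).trans_le ?_)
  linarith [controlRadius_pos (h.exists_isControlled x hx)]

theorem retract_mem (ht : t ∈ Icc (0 : ℝ) 1) (hx : x ∈ M) : r (ψ t x) ∈ M :=
  h.tubular.mapsTo (h.mem_U ht hx)

theorem norm_sub_retract_lt (ht : t ∈ Icc (0 : ℝ) 1) (hx : x ∈ M) :
    ‖ψ t x - r (ψ t x)‖ < controlRadius M U r ε x / 1024 := by
  refine (h.tubular.norm_sub_le hx (h.mem_U ht hx)).trans_lt ?_
  rw [← dist_eq_norm]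
  exact h.dist_lt ht hx

theorem dist_retract_lt (ht : t ∈ Icc (0 : ℝ) 1) (hx : x ∈ M) :
    dist (r (ψ t x)) x < controlRadius M U r ε x / 512 := by
  have h1 := h.norm_sub_retract_lt ht hx
  have h2 := h.dist_lt ht hx
  have h3 := dist_triangle (r (ψ t x)) (ψ t x) x
  rw [dist_eq_norm' (r (ψ t x)) (ψ t x)] at h3
  linarith

theorem differentiableWithinAt (ht : t ∈ Icc (0 : ℝ) 1) (hx : x ∈ M) :
    DifferentiableWithinAt ℝ (ψ t) M x := by
  refine ((h.trivialization.diffeo t ht).1 x hx).differentiableWithinAt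
    (coe_sub_one_ne_zero h.two_le)

/-- On tangent vectors, the differentials of `ψ t` and of `r ∘ ψ t` are close to the identity. -/
theorem exists_bound (ht : t ∈ Icc (0 : ℝ) 1) (hx : x ∈ M) :
    ∃ e : ℝ, 0 < e ∧ e ≤ 1 ∧ controlRadius M U r ε x / 1024 ≤ e / 512 ∧ e ≤ ε (r (ψ t x)) ∧
      ∀ u ∈ tangentVectors M x, ‖u - fderivWithin ℝ (ψ t) M x u‖ ≤ e / 512 * ‖u‖ ∧
        ‖fderiv ℝ r (ψ t x) (fderivWithin ℝ (ψ t) M x u) - u‖ ≤ e / 32 * ‖u‖ := by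
  have hs := controlRadius_pos (h.exists_isControlled x hx)
  have hC := h.isControlled hx
  have hxs : dist x x < controlRadius M U r ε x / 2 := by rw [dist_self]; linarith
  have hψs : dist (ψ t x) x < controlRadius M U r ε x / 2 :=
    (h.dist_lt ht hx).trans_le (by linarith)
  have h3 := hC.norm_fderiv_le hψs
  obtain ⟨e, he0, he1, hρe, hU, -, hosc⟩ := hC
  have hD := norm_fderiv_sub_fderiv_le (by positivity) hosc hψs hxs
    (h.tubular.differentiableAt h.two_le (h.mem_U ht hx))
    (h.tubular.differentiableAt h.two_le (h.tubular.subset hx))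
  refine ⟨e, he0, he1, by linarith, (hU _ ((h.dist_retract_lt ht hx).trans_le (by linarith))).2
    (h.retract_mem ht hx), fun u hu => ?_⟩
  have h1 : ‖u - fderivWithin ℝ (ψ t) M x u‖ ≤ e / 512 * ‖u‖ := by
    rcases eq_or_ne u 0 with rfl | hne
    · simp
    have hpos : 0 < ‖u‖ := norm_pos_iff.2 hne
    have h4 := h.trivialization.close_deriv t ht x hx _ (smul_mem_tangentVectors hu ‖u‖⁻¹)
      (by rw [norm_smul, norm_inv, norm_norm, inv_mul_cancel₀ hpos.ne'])
    rw [map_smul, ← smul_sub, norm_smul, norm_inv, norm_norm, inv_mul_eq_div,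
      div_lt_iff₀ hpos] at h4
    refine h4.le.trans ?_
    gcongr ?_ * _
    linarith
  refine ⟨h1, ?_⟩
  set L := fderivWithin ℝ (ψ t) M x
  have h5 : fderiv ℝ r (ψ t x) (L u) - u =
      -(fderiv ℝ r (ψ t x) (u - L u)) + (fderiv ℝ r (ψ t x) - fderiv ℝ r x) u := by
    rw [map_sub, sub_apply, h.tubular.fderiv_tangentVector h.two_le hx hu]
    abel
  rw [h5]
  refine (norm_add_le _ _).trans ?_
  rw [norm_neg]
  have h6 := (fderiv ℝ r (ψ t x)).le_of_opNorm_le h3 (u - L u)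
  have h7 := (fderiv ℝ r (ψ t x) - fderiv ℝ r x).le_of_opNorm_le hD u
  have h8 : 0 ≤ e * ‖u‖ := by positivity
  nlinarith

theorem dist_retract_le (hx : x ∈ M) (hy : y ∈ U) : dist (r y) x ≤ 2 * dist y x := by
  have h1 := h.tubular.norm_sub_le hx hy
  have h2 := dist_triangle (r y) y x
  rw [dist_eq_norm' (r y) y] at h2
  rw [← dist_eq_norm y x] at h1
  linarith

theorem mem_U_of_dist_lt (hx : x ∈ M) (hy : dist y x < controlRadius M U r ε x / 16) :
    y ∈ U :=
  (h.isControlled hx).mem (hy.trans_le (by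
    linarith [controlRadius_pos (h.exists_isControlled x hx)]))

theorem controlRadius_le (hx : x ∈ M) (hy : y ∈ M) (hyx : dist y x < controlRadius M U r ε x / 2) :
    controlRadius M U r ε y ≤ 2 * controlRadius M U r ε x := by
  have h1 := controlRadius_le_add_dist (h.exists_isControlled x hx) (h.exists_isControlled y hy)
  rw [dist_comm] at h1
  linarith [controlRadius_pos (h.exists_isControlled x hx)]

/-- The displacement of `r ∘ ψ t`, extended to a neighbourhood of `M` by means of `r`, is a
contraction on balls at the scale of the control radius. -/
theorem lipschitz_displacement (ht : t ∈ Icc (0 : ℝ) 1) (hx : x ∈ M)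
    {y z : EuclideanSpace ℝ (Fin n)}
    (hy : y ∈ Metric.ball x (controlRadius M U r ε x / 16))
    (hz : z ∈ Metric.ball x (controlRadius M U r ε x / 16)) :
    ‖(r (ψ t (r y)) - r y) - (r (ψ t (r z)) - r z)‖ ≤ 1 / 2 * ‖y - z‖ := by
  have hs := controlRadius_pos (h.exists_isControlled x hx)
  have hder : ∀ y ∈ Metric.ball x (controlRadius M U r ε x / 16),
      HasFDerivAt (fun y => r (ψ t (r y)) - r y)
        ((fderiv ℝ r (ψ t (r y))).comp ((fderivWithin ℝ (ψ t) M (r y)).comp (fderiv ℝ r y)) -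
          fderiv ℝ r y) y := by
    intro y hy
    have hyU := h.mem_U_of_dist_lt hx hy
    have hry := h.tubular.mapsTo hyU
    have h1 := (h.tubular.differentiableAt h.two_le hyU).hasFDerivAt
    have h2 : HasFDerivAt (fun y => ψ t (r y))
        ((fderivWithin ℝ (ψ t) M (r y)).comp (fderiv ℝ r y)) y :=
      ((h.differentiableWithinAt ht hry).hasFDerivWithinAt.comp (t := M) (s := U) y
        h1.hasFDerivWithinAt h.tubular.mapsTo).hasFDerivAt (h.tubular.isOpen.mem_nhds hyU)
    exact (((h.tubular.differentiableAt h.two_le (h.mem_U ht hry)).hasFDerivAt).comp y h2).sub h1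
  refine (convex_ball x _).norm_image_sub_le_of_norm_hasFDerivWithin_le
    (f := fun y => r (ψ t (r y)) - r y) (fun y hy => (hder y hy).hasFDerivWithinAt)
    (fun y hy => ?_) hz hy
  have hyU := h.mem_U_of_dist_lt hx hy
  refine ContinuousLinearMap.opNorm_le_bound _ (by norm_num) fun w => ?_
  obtain ⟨e, he0, he1, -, -, hb⟩ := h.exists_bound ht (h.tubular.mapsTo hyU)
  have h1 := (hb _ (h.tubular.fderiv_mem_tangentVectors h.two_le hyU w)).2
  have h2 := (fderiv ℝ r y).le_of_opNorm_le ((h.isControlled hx).norm_fderiv_le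
    ((Metric.mem_ball.1 hy).trans_le (by linarith))) w
  have h3 : e / 32 * ‖fderiv ℝ r y w‖ ≤ 1 / 32 * (3 * ‖w‖) := by gcongr
  have h4 := h1.trans h3
  exact h4.trans (by linarith [norm_nonneg w])

theorem norm_displacement_le (ht : t ∈ Icc (0 : ℝ) 1) (hx : x ∈ M)
    (hy : y ∈ Metric.ball x (controlRadius M U r ε x / 16)) :
    ‖r (ψ t (r y)) - r y‖ ≤ controlRadius M U r ε x / 256 := by
  have hyU := h.mem_U_of_dist_lt hx hy
  have hry := h.tubular.mapsTo hyU
  have hs := controlRadius_pos (h.exists_isControlled x hx)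
  have h1 := h.dist_retract_lt ht hry
  have h2 := h.controlRadius_le hx hry ((h.dist_retract_le hx hyU).trans_lt
    (by linarith [Metric.mem_ball.1 hy]))
  rw [← dist_eq_norm]
  linarith

theorem retract_injOn (ht : t ∈ Icc (0 : ℝ) 1) : InjOn (fun x => r (ψ t x)) M := by
  have key : ∀ y ∈ M, dist y (r (ψ t y)) < controlRadius M U r ε (r (ψ t y)) / 16 := by
    intro y hy
    have h1 := h.dist_retract_lt ht hy
    have h2 := controlRadius_le_add_dist (h.exists_isControlled _ (h.retract_mem ht hy))
      (h.exists_isControlled y hy)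
    rw [dist_comm] at h1
    rw [dist_comm] at h2
    have h3 := controlRadius_pos (h.exists_isControlled y hy)
    linarith
  intro y hy z hz hyz
  have hyz' : r (ψ t y) = r (ψ t z) := hyz
  have h1 := h.lipschitz_displacement ht (h.retract_mem ht hy) (key y hy)
    (by rw [hyz']; exact key z hz)
  rw [h.tubular.retraction y hy, h.tubular.retraction z hz, hyz', sub_sub_sub_cancel_left,
    norm_sub_rev] at h1
  have h2 : ‖y - z‖ = 0 := by linarith [norm_nonneg (y - z)]
  exact sub_eq_zero.1 (norm_eq_zero.1 h2)

theorem contDiffOn_displacement (hx : x ∈ M) : ContDiffOn ℝ ((k - 1 : ℕ∞) : WithTop ℕ∞)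
    (fun q : ℝ × EuclideanSpace ℝ (Fin n) => r (ψ q.1 (r q.2)) - r q.2)
    (Icc (0 : ℝ) 1 ×ˢ Metric.ball x (controlRadius M U r ε x / 16)) := by
  have hr : ContDiffOn ℝ ((k - 1 : ℕ∞) : WithTop ℕ∞)
      (fun q : ℝ × EuclideanSpace ℝ (Fin n) => r q.2)
      (Icc (0 : ℝ) 1 ×ˢ Metric.ball x (controlRadius M U r ε x / 16)) :=
    h.tubular.contDiffOn.comp contDiffOn_snd fun q hq => h.mem_U_of_dist_lt hx hq.2
  have hmaps : MapsTo (fun q : ℝ × EuclideanSpace ℝ (Fin n) => (q.1, r q.2))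
      (Icc (0 : ℝ) 1 ×ˢ Metric.ball x (controlRadius M U r ε x / 16)) (Icc (0 : ℝ) 1 ×ˢ M) :=
    fun q hq => ⟨hq.1, h.tubular.mapsTo (h.mem_U_of_dist_lt hx hq.2)⟩
  have hψ : ContDiffOn ℝ ((k - 1 : ℕ∞) : WithTop ℕ∞)
      (fun q : ℝ × EuclideanSpace ℝ (Fin n) => ψ q.1 (r q.2))
      (Icc (0 : ℝ) 1 ×ˢ Metric.ball x (controlRadius M U r ε x / 16)) :=
    h.trivialization.contDiffOn.comp (contDiffOn_fst.prodMk hr) hmaps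
  exact (h.tubular.contDiffOn.comp hψ fun q hq => h.mem_U hq.1 (hmaps hq).2).sub hr

/-- Local smooth inverse of `r ∘ ψ t`, jointly in the parameter. -/
theorem exists_local_inverse (hx : x ∈ M) :
    ∃ R > 0, ∃ g : ℝ × EuclideanSpace ℝ (Fin n) → EuclideanSpace ℝ (Fin n),
      ContDiffOn ℝ ((k - 1 : ℕ∞) : WithTop ℕ∞) g (Icc (0 : ℝ) 1 ×ˢ Metric.ball x R) ∧
      ∀ t ∈ Icc (0 : ℝ) 1, ∀ z ∈ M, z ∈ Metric.ball x R →
        g (t, z) ∈ M ∧ r (ψ t (g (t, z))) = z := by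
  have hs := controlRadius_pos (h.exists_isControlled x hx)
  obtain ⟨g, hg, hgs⟩ := exists_contDiffOn_inverse (one_le_sub_one h.two_le)
    (h.contDiffOn_displacement hx)
    (fun t ht y hy z hz => h.lipschitz_displacement ht hx hy hz)
    (fun t ht y hy => (h.norm_displacement_le ht hx hy).trans (by linarith))
  refine ⟨_, by positivity, g, hg, fun t ht z hzM hz => ?_⟩
  obtain ⟨hyb, hyz⟩ := hgs t ht z hz
  generalize g (t, z) = y at hyb hyz ⊢
  simp only at hyz
  have hyU := h.mem_U_of_dist_lt hx hyb
  have hm := h.tubular.mapsTo hyU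
  have hmx := h.dist_retract_le hx hyU
  have hd := h.norm_displacement_le ht hx hyb
  rw [← dist_eq_norm] at hd
  have hyb' := Metric.mem_ball.1 hyb
  have hz' := Metric.mem_ball.1 hz
  -- `y` and `z` are the translates of `r y` and `r (ψ t (r y))` by the same vector `v`; the
  -- increments of `r` along these translations are `0` and `v`
  have hv1 : r y + (y - r y) = y := by abel
  have hv2 : r (ψ t (r y)) + (y - r y) = z := by
    rw [← hyz]
    abel
  obtain ⟨e, he0, he1, -, -, -, hosc⟩ := h.isControlled hx
  have h1 := hosc (r y) (by linarith) (r (ψ t (r y)))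
    (by linarith [dist_triangle (r (ψ t (r y))) (r y) x]) (y - r y)
    (by rw [hv1]; linarith) (by rw [hv2]; linarith)
  rw [hv1, hv2, h.tubular.retraction _ hm, h.tubular.retraction _ hzM,
    h.tubular.retraction _ (h.retract_mem ht hm), sub_self, zero_sub, norm_neg, ← hv2,
    add_sub_cancel_left] at h1
  have h2 : ‖y - r y‖ = 0 := by nlinarith [norm_nonneg (y - r y)]
  have h3 : y = r y := sub_eq_zero.1 (norm_eq_zero.1 h2)
  rw [← h3] at hm hyz
  exact ⟨hm, by rw [← hyz]; abel⟩

theorem retract_bijOn (ht : t ∈ Icc (0 : ℝ) 1) : BijOn (fun x => r (ψ t x)) M M := by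
  refine ⟨fun x hx => h.retract_mem ht hx, h.retract_injOn ht, fun x hx => ?_⟩
  obtain ⟨R, hR, g, -, hg⟩ := h.exists_local_inverse hx
  obtain ⟨h1, h2⟩ := hg t ht x hx (Metric.mem_ball_self hR)
  exact ⟨_, h1, h2⟩

end IsControlledTrivialization
end

/-! ### The definable trivialization -/

section
variable {n : ℕ} {M U : Set (EuclideanSpace ℝ (Fin n))}
  {r : EuclideanSpace ℝ (Fin n) → EuclideanSpace ℝ (Fin n)} {ε : EuclideanSpace ℝ (Fin n) → ℝ}
  {x y : EuclideanSpace ℝ (Fin n)} {S : OMinimalStructure} {k : ℕ∞}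
  {Z : ℝ → Set (EuclideanSpace ℝ (Fin n))}
  {ψ : ℝ → EuclideanSpace ℝ (Fin n) → EuclideanSpace ℝ (Fin n)} {t : ℝ}

/-- The inverse of the self-map `r ∘ ψ t` of `M`. -/
noncomputable def retractInverse (M : Set (EuclideanSpace ℝ (Fin n)))
    (r : EuclideanSpace ℝ (Fin n) → EuclideanSpace ℝ (Fin n))
    (ψ : ℝ → EuclideanSpace ℝ (Fin n) → EuclideanSpace ℝ (Fin n)) (t : ℝ) :
    EuclideanSpace ℝ (Fin n) → EuclideanSpace ℝ (Fin n) :=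
  Function.invFunOn (fun x => r (ψ t x)) M

namespace IsControlledTrivialization

variable (h : IsControlledTrivialization S k M U r ε Z ψ)
include h

theorem retractInverse_mem (ht : t ∈ Icc (0 : ℝ) 1) (hx : x ∈ M) : retractInverse M r ψ t x ∈ M :=
  Function.invFunOn_mem ((h.retract_bijOn ht).surjOn hx)

theorem retract_retractInverse (ht : t ∈ Icc (0 : ℝ) 1) (hx : x ∈ M) :
    r (ψ t (retractInverse M r ψ t x)) = x :=
  Function.invFunOn_eq ((h.retract_bijOn ht).surjOn hx)

theorem retractInverse_eq (ht : t ∈ Icc (0 : ℝ) 1) (hy : y ∈ M) (hyx : r (ψ t y) = x) :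
    retractInverse M r ψ t x = y := by
  have hx : x ∈ M := hyx ▸ h.retract_mem ht hy
  exact h.retract_injOn ht (h.retractInverse_mem ht hx) hy
    ((h.retract_retractInverse ht hx).trans hyx.symm)

theorem contDiffOn_retractInverse : ContDiffOn ℝ ((k - 1 : ℕ∞) : WithTop ℕ∞)
    (fun q : ℝ × EuclideanSpace ℝ (Fin n) => retractInverse M r ψ q.1 q.2)
    (Icc (0 : ℝ) 1 ×ˢ M) := by
  rintro ⟨t, x⟩ ⟨ht, hx⟩
  obtain ⟨R, hR, g, hg, hgM⟩ := h.exists_local_inverse hx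
  have h1 := (hg (t, x) ⟨ht, Metric.mem_ball_self hR⟩).mono
    (prod_mono_right (inter_subset_right (s := M)))
  have h2 : ContDiffWithinAt ℝ ((k - 1 : ℕ∞) : WithTop ℕ∞)
      (fun q : ℝ × EuclideanSpace ℝ (Fin n) => retractInverse M r ψ q.1 q.2)
      (Icc (0 : ℝ) 1 ×ˢ (M ∩ Metric.ball x R)) (t, x) := by
    refine h1.congr (fun q hq => ?_) ?_
    · obtain ⟨h3, h4⟩ := hgM q.1 hq.1 q.2 hq.2.1 hq.2.2
      exact h.retractInverse_eq hq.1 h3 h4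
    · obtain ⟨h3, h4⟩ := hgM t ht x hx (Metric.mem_ball_self hR)
      exact h.retractInverse_eq ht h3 h4
  refine h2.mono_of_mem_nhdsWithin ?_
  refine mem_nhdsWithin.2 ⟨univ ×ˢ Metric.ball x R, isOpen_univ.prod Metric.isOpen_ball,
    ⟨mem_univ _, Metric.mem_ball_self hR⟩, ?_⟩
  rintro q ⟨⟨-, hq1⟩, hq2, hq3⟩
  exact ⟨hq2, hq3, hq1⟩

theorem contDiffOn_retractInverse_right (ht : t ∈ Icc (0 : ℝ) 1) :
    ContDiffOn ℝ ((k - 1 : ℕ∞) : WithTop ℕ∞) (retractInverse M r ψ t) M :=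
  h.contDiffOn_retractInverse.comp (contDiffOn_const.prodMk contDiffOn_id) fun _ hx => ⟨ht, hx⟩

theorem retract_right_inv (ht : t ∈ Icc (0 : ℝ) 1) (hx : y ∈ Z t) :
    y ∈ U ∧ ψ t (retractInverse M r ψ t (r y)) = y := by
  obtain ⟨-, -, g, -, hg, -, hinv⟩ := h.trivialization.diffeo t ht
  have h1 : ψ t (g y) = y := hinv hx
  have h2 := h.mem_U ht (hg hx)
  have h3 := h.retractInverse_eq ht (hg hx) (x := r y) (by rw [h1])
  rw [h3]
  exact ⟨h1 ▸ h2, h1⟩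

theorem invOn (ht : t ∈ Icc (0 : ℝ) 1) :
    InvOn r (fun x => ψ t (retractInverse M r ψ t x)) M (Z t) :=
  ⟨fun _ hx => h.retract_retractInverse ht hx, fun _ hy => (h.retract_right_inv ht hy).2⟩

/-- The inverse of `r` on `Z t` is as close to the identity as required, because both `ψ t` and the
inverse of `r ∘ ψ t` are. -/
theorem isTrivialization :
    IsTrivialization (k - 1) ε M Z fun t x => ψ t (retractInverse M r ψ t x) := by
  have hjoint : ContDiffOn ℝ ((k - 1 : ℕ∞) : WithTop ℕ∞)
      (fun q : ℝ × EuclideanSpace ℝ (Fin n) => ψ q.1 (retractInverse M r ψ q.1 q.2))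
      (Icc (0 : ℝ) 1 ×ˢ M) :=
    h.trivialization.contDiffOn.comp (contDiffOn_fst.prodMk h.contDiffOn_retractInverse)
      fun q hq => ⟨hq.1, h.retractInverse_mem hq.1 hq.2⟩
  have hsmooth : ∀ t ∈ Icc (0 : ℝ) 1, ContDiffOn ℝ ((k - 1 : ℕ∞) : WithTop ℕ∞)
      (fun x => ψ t (retractInverse M r ψ t x)) M := fun t ht =>
    hjoint.comp (contDiffOn_const.prodMk contDiffOn_id) fun _ hx => ⟨ht, hx⟩
  refine ⟨fun t ht => ⟨hsmooth t ht, fun x hx => ?_, r, ?_, fun y hy => ?_, h.invOn ht⟩, hjoint,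
    fun x hx => ?_, fun t ht x hx => ?_, fun t ht x hx u hu hu1 => ?_⟩
  · exact (h.trivialization.diffeo t ht).2.1 (h.retractInverse_mem ht hx)
  · exact h.tubular.contDiffOn.mono fun y hy => (h.retract_right_inv ht hy).1
  · exact h.tubular.mapsTo (h.retract_right_inv ht hy).1
  · have h0 : (0 : ℝ) ∈ Icc (0 : ℝ) 1 := ⟨le_rfl, zero_le_one⟩
    change ψ 0 (retractInverse M r ψ 0 x) = x
    rw [h.retractInverse_eq h0 hx (x := x) (by
      rw [h.trivialization.zero x hx, h.tubular.retraction x hx]), h.trivialization.zero x hx]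
  · have hm := h.retractInverse_mem ht hx
    obtain ⟨e, he0, -, hδ, heε, -⟩ := h.exists_bound ht hm
    have h1 := h.norm_sub_retract_lt ht hm
    rw [h.retract_retractInverse ht hx] at h1 heε
    rw [norm_sub_rev]
    linarith
  · have hm := h.retractInverse_mem ht hx
    obtain ⟨e, he0, he1, -, heε, hb⟩ := h.exists_bound ht hm
    rw [h.retract_retractInverse ht hx] at heε
    have hne := coe_sub_one_ne_zero h.two_le
    obtain ⟨γ, rfl, hγM, hγ⟩ := hu
    -- follow a curve with velocity `u` through `r ∘ ψ t` backwards
    have hw := fderivWithin_apply_tangentVector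
      ((h.contDiffOn_retractInverse_right ht _ hx).differentiableWithinAt hne) rfl hγM hγ
    set w := fderivWithin ℝ (retractInverse M r ψ t) M (γ 0) u
    have hηM : ∀ᶠ s in 𝓝 (0 : ℝ), (retractInverse M r ψ t ∘ γ) s ∈ M :=
      hγM.mono fun s hs => h.retractInverse_mem ht hs
    have hd1 := fderivWithin_apply_tangentVector (h.differentiableWithinAt ht hm) rfl hηM hw
    have hd2 := fderivWithin_apply_tangentVector
      ((hsmooth t ht _ hx).differentiableWithinAt hne) rfl hγM hγ
    have hd : fderivWithin ℝ (fun x => ψ t (retractInverse M r ψ t x)) M (γ 0) u =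
        fderivWithin ℝ (ψ t) M (retractInverse M r ψ t (γ 0)) w := hd2.unique hd1
    have hwM : w ∈ tangentVectors M (retractInverse M r ψ t (γ 0)) := ⟨_, rfl, hηM, hw⟩
    have hu' : fderiv ℝ r (ψ t (retractInverse M r ψ t (γ 0)))
        (fderivWithin ℝ (ψ t) M (retractInverse M r ψ t (γ 0)) w) = u := by
      refine (HasFDerivAt.comp_hasDerivAt (0 : ℝ)
        (h.tubular.differentiableAt h.two_le (h.mem_U ht hm)).hasFDerivAt hd1).unique
        (hγ.congr_of_eventuallyEq ?_)
      filter_upwards [hγM] with s hs using h.retract_retractInverse ht hs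
    obtain ⟨hb1, hb2⟩ := hb w hwM
    rw [hu'] at hb2
    rw [hd]
    set L := fderivWithin ℝ (ψ t) M (retractInverse M r ψ t (γ 0))
    have h1 : ‖w‖ ≤ 1 + e / 32 * ‖w‖ := by
      have := norm_sub_norm_le w u
      rw [norm_sub_rev, hu1] at this
      linarith
    have h2 : ‖w‖ ≤ 2 := by nlinarith [norm_nonneg w]
    have h3 : ‖u - L w‖ ≤ ‖u - w‖ + ‖w - L w‖ := norm_sub_le_norm_sub_add_norm_sub _ _ _
    have h4 : e * ‖w‖ ≤ e * 2 := by gcongr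
    nlinarith

open OMinimalStructure in
theorem isDefinableMapFamily (hZ : S.IsDefinableFamily Z) :
    S.IsDefinableMapFamily M fun t x => ψ t (retractInverse M r ψ t x) := by
  rw [isDefinableMapFamily_iff]
  rw [isDefinableFamily_iff] at hZ
  refine ((hZ.comp (.prodMk (.fst .id) (.snd (.snd .id)))).and
    ((isDefinableMap_iff.1 h.tubular.definable_map).comp
      (.prodMk (.snd (.snd .id)) (.fst (.snd .id))))).congr fun p => ?_
  obtain ⟨t, x, y⟩ := p
  constructor
  · rintro ⟨⟨ht, hy⟩, hyU, hxy⟩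
    simp only at ht hy hyU hxy ⊢
    subst hxy
    exact ⟨ht, h.tubular.mapsTo hyU, (h.retract_right_inv ht hy).2.symm⟩
  · rintro ⟨ht, hx, hy⟩
    simp only at ht hx hy ⊢
    have hyZ : y ∈ Z t := hy ▸ (h.isTrivialization.diffeo t ht).2.1 hx
    refine ⟨⟨ht, hyZ⟩, (h.retract_right_inv ht hyZ).1, ?_⟩
    rw [hy, h.retract_retractInverse ht hx]

end IsControlledTrivialization
end

theorem mainTheorem2 (S : OMinimalStructure) {n : ℕ} (k : ℕ∞) (hk : 2 ≤ k)
    (M : Set (EuclideanSpace ℝ (Fin n))) (hclosed : IsClosed M) (hdef : S.IsDefinable M)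
    (hM : IsSubmanifold k M)
    (ε : EuclideanSpace ℝ (Fin n) → ℝ) (hε : S.IsPosDefinable M ε) :
    (∃ (U : Set (EuclideanSpace ℝ (Fin n)))
      (r : EuclideanSpace ℝ (Fin n) → EuclideanSpace ℝ (Fin n)),
      IsTubularNeighborhood S k M U r) ∧
    ∀ (U : Set (EuclideanSpace ℝ (Fin n)))
      (r : EuclideanSpace ℝ (Fin n) → EuclideanSpace ℝ (Fin n)),
      IsTubularNeighborhood S k M U r →
      ∃ δ : EuclideanSpace ℝ (Fin n) → ℝ, S.IsPosDefinable M δ ∧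
        ∀ Z : ℝ → Set (EuclideanSpace ℝ (Fin n)),
          IsDefinableDeformation S (k - 1) M Z → IsTrivial (k - 1) δ M Z →
          ∃ φ : ℝ → EuclideanSpace ℝ (Fin n) → EuclideanSpace ℝ (Fin n),
            IsDefinableTrivialization S (k - 1) ε M Z φ ∧
            ∀ t ∈ Icc (0 : ℝ) 1, Z t ⊆ U ∧ InvOn r (φ t) M (Z t) := by
  refine ⟨exists_isTubularNeighborhood S hk hclosed hdef hM, fun U r hU => ?_⟩
  refine ⟨fun x => controlRadius M U r ε x / 1024,
    hU.isPosDefinable_controlRadius hk hdef hε (by norm_num), fun Z hZ ⟨ψ, hψ⟩ => ?_⟩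
  have h : IsControlledTrivialization S k M U r ε Z ψ :=
    ⟨hk, hU, fun x hx => hU.exists_isControlled hk hε.continuousOn hε.pos hx, hψ⟩
  exact ⟨_, ⟨h.isTrivialization, h.isDefinableMapFamily hZ.definable⟩,
    fun t ht => ⟨fun y hy => (h.retract_right_inv ht hy).1, h.invOn ht⟩⟩
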